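/- **Setting.** Let $S$ be a finite set, $\mathcal I$ an index set, and for each $\iota\in\mathcal I$ let $\emptyset\ne\mathcal K_\iota\subseteq S$. For $N\ge 1$ put $\mathcal M^{(N)}=\bigotimes_{s\in S}M_N(\mathbb C)$ and $$\mathcal M^{(N)}_\iota=\bigotimes_{s\in\mathcal K_\iota}M_N(\mathbb C)\otimes\bigotimes_{s\in S\setminus\mathcal K_\iota}\mathbb C 1_N\subseteq\mathcal M^{(N)} .$$ Let $(U_\iota)_{\iota\in\mathcal I}$ be independent random unitaries, $U_\iota$ Haar-distributed on the unitary group of $\mathcal M^{(N)}_\iota$. Fix $k\ge 1$, a word $\iota_1,\dots,\iota_k\in\mathcal I$ and deterministic $A_j\in\mathcal M^{(N)}_{\iota_j}$, and write $U_j:=U_{\iota_j}$. **Notation.** $\operatorname{tr}$ is the normalized trace, $E$ is expectation, and $\#(\cdot)$ is the number of cycles of a permutation of a finite set, fixed points included. For $\sigma\in S_k$, $\operatorname{tr}_\sigma(A_1,\dots,A_k)$ is the product over all cycles $(i,\sigma(i),\sigma^2(i),\dots)$ of $\sigma$ of $\operatorname{tr}(A_iA_{\sigma(i)}A_{\sigma^2(i)}\cdots)$.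 Let $Z=(1\,2\cdots k)$, $B_\iota=\{j:\iota_j=\iota\}$, $J_s=\{j: s\in\mathcal K_{\iota_j}\}$, and let $\tilde S_k=\{\sigma\in S_k:\iota_{\sigma(j)}=\iota_j\ \text{for all } j\}$ be the stabilizer of the word. For $\sigma\in\tilde S_k$ let $\sigma_s$ be the permutation of $J_s$ induced by $\sigma$; write $\#_{J_s}(\sigma_s)$ for its number of cycles on $J_s$, and $\#_k(Z^{-1}\sigma_s)$ for the number of cycles on $\{1,\dots,k\}$ of $Z^{-1}\sigma_s$, where $\sigma_s$ is extended by the identity outside $J_s$. For a finite set $B$ and $d\ge 1$, the unitary Weingarten function $\operatorname{Wg}(\cdot,d)$ on the permutation group $S_B$ is $\operatorname{Wg}(\sigma,d)=W_{\mathrm{id},\sigma}$, where $W$ is the Moore–Penrose inverse of the matrix $\big(d^{\#(\sigma^{-1}\tau)}\big)_{\sigma,\tau\in S_B}$ (the ordinary inverse when $d\ge\#B$). Put $$\widetilde{\operatorname{Wg}}(\sigma,N)=\prod_{\iota:\,B_\iota\ne\emptyset}\operatorname{Wg}\big(\sigma|_{B_\iota},N^{\#\mathcal K_\iota}\big),\qquad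 \sigma\in\tilde S_k .$$ **Theorem.** For every $N\ge1$, the random variable $\operatorname{tr}(U_1A_1U_1^*\cdots U_kA_kU_k^*)$ is integrable and $$E\big(\operatorname{tr}(U_1A_1U_1^*\cdots U_kA_kU_k^*)\big)=\sum_{\sigma,\tau\in\tilde S_k}\widetilde{\operatorname{Wg}}(\sigma^{-1}\tau,N)\,\operatorname{tr}_\sigma(A_1,\dots,A_k)\prod_{s\in S}N^{\#_k(Z^{-1}\tau_s)+\#_{J_s}(\sigma_s)-1}.$$ -/

import Mathlib

open MeasureTheory ProbabilityTheory Equiv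

noncomputable section

namespace EpsWeingarten

/-! ### Permutations, cycles and traces along cycles -/

/-- `#σ`: the number of cycles of a permutation of a finite set, fixed points included
(the number of orbits of `σ`). -/
def numCycles {α : Type*} (σ : Perm α) : ℕ :=
  Nat.card (Quotient (Perm.SameCycle.setoid σ))

/-- The normalized trace on a matrix algebra. -/
def ntr {n : Type*} [Fintype n] (X : Matrix n n ℂ) : ℂ :=
  (Fintype.card n : ℂ)⁻¹ * X.trace

/-- The ordered product `A i * A (σ i) * A (σ² i) * ⋯` once around the cycle of `σ` through `i`. -/
def cycleProd {α n : Type*} [Fintype n] [DecidableEq n] (σ : Perm α)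
    (A : α → Matrix n n ℂ) (i : α) : Matrix n n ℂ :=
  ((List.range (Function.minimalPeriod σ i)).map fun m => A ((σ ^ m) i)).prod

/-- `tr_σ(A)`: the product over all cycles of `σ` of the normalized trace of the product of the
matrices along the cycle. By traciality the starting point in each cycle is irrelevant. -/
def trPerm {α n : Type*} [Fintype n] [DecidableEq n] (σ : Perm α)
    (A : α → Matrix n n ℂ) : ℂ :=
  ∏ᶠ c : Quotient (Perm.SameCycle.setoid σ), ntr (cycleProd σ A c.out)

/-! ### The unitary Weingarten function -/

/-- The Gram matrix `(σ, τ) ↦ d ^ #(σ⁻¹τ)` of the permutation operators on `(ℂ^d)^{⊗ α}`. -/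
def gramMatrix (α : Type*) (d : ℕ) : Matrix (Perm α) (Perm α) ℂ :=
  Matrix.of fun σ τ => (d : ℂ) ^ numCycles (σ⁻¹ * τ)

/-- The Moore–Penrose inverse of the Gram matrix, obtained by applying `x ↦ x⁻¹` (with `0⁻¹ = 0`)
to its spectrum; the spectrum is finite, so every function is continuous on it. If the Gram matrix
is invertible, in particular for `d ≥ #α`, this is its inverse. -/
def weingartenMatrix (α : Type*) [Fintype α] [DecidableEq α] (d : ℕ) :
    Matrix (Perm α) (Perm α) ℂ :=
  cfc (fun x : ℝ => x⁻¹) (gramMatrix α d)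

/-- The unitary Weingarten function `Wg(σ, d)` on the permutations of a finite set: the
convolution (pseudo-)inverse of `σ ↦ d ^ #σ`, i.e. the first row of the Weingarten matrix. -/
def Wg {α : Type*} [Fintype α] [DecidableEq α] (σ : Perm α) (d : ℕ) : ℂ :=
  weingartenMatrix α d 1 σ

/-! ### The tensor product algebra and its leg subalgebras -/

/-- The algebra `⊗_{s ∈ S} M_N(ℂ)`, as matrices indexed by the standard basis of
`⊗_{s ∈ S} ℂ^N`. -/
abbrev TensorMatrix (S : Type*) (N : ℕ) : Type _ := Matrix (S → Fin N) (S → Fin N) ℂ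

/-- The amplification `B ↦ B ⊗ 1` from the legs in `K` to all legs. -/
def amplify {S : Type*} [Fintype S] [DecidableEq S] (K : Finset S) (N : ℕ)
    (B : Matrix (K → Fin N) (K → Fin N) ℂ) : TensorMatrix S N :=
  Matrix.of fun i j =>
    if ∀ s, s ∉ K → i s = j s then B (fun s => i s) (fun s => j s) else 0

theorem amplify_one {S : Type*} [Fintype S] [DecidableEq S] (K : Finset S) (N : ℕ) :
    amplify K N 1 = 1 := by
  ext i j
  simp only [amplify, Matrix.of_apply, Matrix.one_apply]
  by_cases h : i = j
  · subst h; simp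
  · rw [if_neg h]
    split_ifs with h1 h2
    · refine absurd (funext fun s => ?_) h
      by_cases hs : s ∈ K
      · exact congrFun h2 ⟨s, hs⟩
      · exact h1 s hs
    · rfl
    · rfl

theorem amplify_smul {S : Type*} [Fintype S] [DecidableEq S] (K : Finset S) (N : ℕ) (c : ℂ)
    (B : Matrix (K → Fin N) (K → Fin N) ℂ) : amplify K N (c • B) = c • amplify K N B := by
  ext i j
  simp [amplify]

theorem amplify_add {S : Type*} [Fintype S] [DecidableEq S] (K : Finset S) (N : ℕ)
    (B C : Matrix (K → Fin N) (K → Fin N) ℂ) :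
    amplify K N (B + C) = amplify K N B + amplify K N C := by
  ext i j
  simp only [amplify, Matrix.of_apply, Matrix.add_apply]
  split_ifs <;> simp

theorem amplify_star {S : Type*} [Fintype S] [DecidableEq S] (K : Finset S) (N : ℕ)
    (B : Matrix (K → Fin N) (K → Fin N) ℂ) : amplify K N (star B) = star (amplify K N B) := by
  ext i j
  simp only [amplify, Matrix.of_apply, Matrix.star_apply]
  have : (∀ s, s ∉ K → i s = j s) ↔ (∀ s, s ∉ K → j s = i s) :=
    forall₂_congr fun _ _ => eq_comm
  by_cases h : ∀ s, s ∉ K → i s = j s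
  · rw [if_pos h, if_pos (this.1 h)]
  · rw [if_neg h, if_neg (fun h' => h (this.2 h')), star_zero]

theorem amplify_mul {S : Type*} [Fintype S] [DecidableEq S] (K : Finset S) (N : ℕ)
    (B C : Matrix (K → Fin N) (K → Fin N) ℂ) :
    amplify K N (B * C) = amplify K N B * amplify K N C := by
  classical
  ext i j
  simp only [amplify, Matrix.of_apply, Matrix.mul_apply]
  by_cases h : ∀ s, s ∉ K → i s = j s
  · rw [if_pos h]
    refine Finset.sum_of_injOn (fun (l : K → Fin N) (s : S) => if hs : s ∈ K then l ⟨s, hs⟩ else i s)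
      ?_ (by simp) ?_ ?_
    · intro l _ l' _ hl
      funext s
      have := congrFun hl s
      simpa using this
    · intro x _ hx
      by_cases hx' : ∀ s, s ∉ K → i s = x s
      · refine absurd ⟨fun s => x s, Finset.mem_coe.2 (Finset.mem_univ _), funext fun s => ?_⟩ hx
        by_cases hs : s ∈ K
        · simp [hs]
        · simp [hs, hx' s hs]
      · rw [if_neg hx', zero_mul]
    · intro l _
      rw [if_pos (by intro s hs; simp [hs]), if_pos (by intro s hs; simp [hs, h s hs])]
      simp
  · rw [if_neg h]
    refine (Finset.sum_eq_zero fun x _ => ?_).symm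
    by_cases h1 : ∀ s, s ∉ K → i s = x s
    · by_cases h2 : ∀ s, s ∉ K → x s = j s
      · exact absurd (fun s hs => (h1 s hs).trans (h2 s hs)) h
      · rw [if_neg h2, mul_zero]
    · rw [if_neg h1, zero_mul]

/-- The subalgebra `⊗_{s ∈ K} M_N(ℂ) ⊗ ⊗_{s ∉ K} ℂ 1_N` of `⊗_{s ∈ S} M_N(ℂ)`. -/
def legAlgebra {S : Type*} [Fintype S] [DecidableEq S] (K : Finset S) (N : ℕ) :
    StarSubalgebra ℂ (TensorMatrix S N) where
  carrier := Set.range (amplify K N)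
  mul_mem' := by
    rintro _ _ ⟨B, rfl⟩ ⟨C, rfl⟩
    exact ⟨B * C, amplify_mul K N B C⟩
  add_mem' := by
    rintro _ _ ⟨B, rfl⟩ ⟨C, rfl⟩
    exact ⟨B + C, amplify_add K N B C⟩
  algebraMap_mem' := fun c =>
    ⟨c • 1, by rw [amplify_smul, amplify_one, Algebra.algebraMap_eq_smul_one]⟩
  star_mem' := by
    rintro _ ⟨B, rfl⟩
    exact ⟨star B, amplify_star K N B⟩

/-- The unitary group of the leg algebra, with the topology of a subspace of the matrices. -/
abbrev LegUnitary {S : Type*} [Fintype S] [DecidableEq S] (K : Finset S) (N : ℕ) : Type _ :=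
  unitary (legAlgebra K N)

instance {S : Type*} [Fintype S] [DecidableEq S] (K : Finset S) (N : ℕ) :
    MeasurableSpace (LegUnitary K N) := borel _

instance {S : Type*} [Fintype S] [DecidableEq S] (K : Finset S) (N : ℕ) :
    BorelSpace (LegUnitary K N) := ⟨rfl⟩

/-- A unitary of the leg algebra, as an element of the full tensor product. -/
def LegUnitary.toMatrix {S : Type*} [Fintype S] [DecidableEq S] {K : Finset S} {N : ℕ}
    (u : LegUnitary K N) : TensorMatrix S N :=
  ((u : legAlgebra K N) : TensorMatrix S N)

/-- `U_1 A_1 U_1^* ⋯ U_k A_k U_k^*`, where `U_j = u (w j)`. -/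
def wordProd {S I : Type*} [Fintype S] [DecidableEq S] {K : I → Finset S} {N k : ℕ} (w : Fin k → I)
    (A : Fin k → TensorMatrix S N) (u : ∀ i, LegUnitary (K i) N) : TensorMatrix S N :=
  (List.ofFn fun j => (u (w j)).toMatrix * A j * star (u (w j)).toMatrix).prod

/-! ### Stabilizer of a word, induced permutations, and the modified Weingarten function -/

/-- The subgroup of all permutations `σ` with `w (σ j) = w j` for all `j`. -/
def wordStabilizer {I : Type*} {k : ℕ} (w : Fin k → I) : Subgroup (Perm (Fin k)) where
  carrier := {σ | ∀ j, w (σ j) = w j}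
  mul_mem' := fun {σ τ} hσ hτ j => (hσ (τ j)).trans (hτ j)
  one_mem' := fun _ => rfl
  inv_mem' := fun {σ} hσ j => by
    have h := hσ (σ⁻¹ j)
    rw [← Perm.mul_apply, mul_inv_cancel, Perm.one_apply] at h
    exact h.symm

instance {I : Type*} {k : ℕ} (w : Fin k → I) : Fintype (wordStabilizer w) := Fintype.ofFinite _

/-- The restriction `σ|_{B_i}` of `σ` to the block `B_i = {j | w j = i}`. -/
def blockPerm {I : Type*} {k : ℕ} {w : Fin k → I} (σ : wordStabilizer w) (i : I) :
    Perm {j // w j = i} :=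
  (σ : Perm (Fin k)).subtypePerm fun j => by rw [σ.2 j]

/-- The permutation `σ_s` induced by `σ` on `J_s = {j | s ∈ K (w j)}`. -/
def stringPerm {S I : Type*} (K : I → Finset S) {k : ℕ} {w : Fin k → I} (σ : wordStabilizer w)
    (s : S) : Perm {j // s ∈ K (w j)} :=
  (σ : Perm (Fin k)).subtypePerm fun j => by rw [σ.2 j]

/-- `σ_s` viewed as a permutation of `{1, …, k}` that fixes every point outside `J_s`. -/
def stringPermExt {S I : Type*} [DecidableEq S] (K : I → Finset S) {k : ℕ} {w : Fin k → I}
    (σ : wordStabilizer w) (s : S) : Perm (Fin k) :=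
  Perm.ofSubtype (stringPerm K σ s)

/-- The product of the Weingarten functions `Wg(σ|_{B_i}, N ^ #K_i)` over the nonempty blocks
`B_i` of the word `w`. -/
def wgTilde {S I : Type*} [DecidableEq I] (K : I → Finset S) {k : ℕ} {w : Fin k → I}
    (σ : wordStabilizer w) (N : ℕ) : ℂ :=
  ∏ i ∈ Finset.univ.image w, Wg (blockPerm σ i) (N ^ (K i).card)

end EpsWeingarten

end

/-!
The index sums in `tr (U₁ A₁ U₁* ⋯ U_k A_k U_k*)` are expanded along the closed path
`p_j, b_j, c_j, p_{j+1}`, and the expectation is taken of the products of entries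
`U_j(p_j, b_j) * conj U_j(p_{j+1}, c_j)`. By independence such a moment is a product over the blocks
of the word, and each factor is a moment of a single Haar unitary, which the Weingarten formula
(`integral_entryProd`) evaluates as a sum over two permutations of the block. The pairs of
permutations of all blocks together are the pairs `σ, τ` in the stabilizer of the word.

The Weingarten formula holds for all dimensions. By left invariance the matrix of moments commutes
with all `V^{⊗ B}`, `V` unitary, so it is a combination of permutation operators
(`exists_eq_sum_permOp`), and the coefficients are recovered from its inner products with the
permutation operators by any generalized inverse of their Gram matrix; the Moore–Penrose inverse is
one. The instance of Schur–Weyl duality needed here comes from three elementary steps. Commuting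
with a tensor power is a polynomial condition, so it passes from unitaries to all matrices; by
polarization it passes on to all matrices invariant under permutations of the tensor factors; and an
averaged projection onto the span of the permutation operators has such matrices as its slices,
which forces a matrix in the commutant to lie in that span.

For fixed `σ` and `τ` the Kronecker deltas are resolved leg by leg (`sum_constrained_eq`). The
indices `p` on the leg `s`, shifted by `Z`, are constant along the cycles of `Z⁻¹ τ_s`, which gives
a power of `N`, and what remains is a product of traces along the cycles of `σ` over the active legs only
(`innerTrace_eq`).
-/

noncomputable section

namespace EpsWeingarten

/-! ### Tensor powers and permutation operators -/

section SchurWeyl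

variable {B n : Type*} [Fintype B] [DecidableEq B] [Fintype n] [DecidableEq n]

/-- The tensor power `X^{⊗ B}`, as a matrix indexed by the standard basis `B → n` of
`(ℂ^n)^{⊗ B}`. -/
def tensorPow (B : Type*) [Fintype B] (X : Matrix n n ℂ) : Matrix (B → n) (B → n) ℂ :=
  Matrix.of fun a b => ∏ j, X (a j) (b j)

/-- The operator on `(ℂ^n)^{⊗ B}` permuting the tensor factors by `σ`. The convention
`(a, b) ↦ [a ∘ σ = b]` makes `permOp` multiplicative. -/
def permOp (n : Type*) [DecidableEq n] (σ : Perm B) : Matrix (B → n) (B → n) ℂ :=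
  Matrix.of fun a b => if a ∘ σ = b then 1 else 0

omit [DecidableEq n] in
theorem tensorPow_mul (X Y : Matrix n n ℂ) :
    tensorPow B (X * Y) = tensorPow B X * tensorPow B Y := by
  ext a b
  simp only [tensorPow, Matrix.of_apply, Matrix.mul_apply, Fintype.prod_sum,
    Finset.prod_mul_distrib]

omit [DecidableEq B] [Fintype n] in
theorem tensorPow_one : tensorPow B (1 : Matrix n n ℂ) = 1 := by
  ext a b
  simp only [tensorPow, Matrix.of_apply, Matrix.one_apply, Finset.prod_ite_zero,
    Finset.prod_const_one, Finset.mem_univ, true_implies, funext_iff]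

omit [DecidableEq B] [Fintype n] [DecidableEq n] in
theorem tensorPow_star (X : Matrix n n ℂ) : tensorPow B (star X) = star (tensorPow B X) := by
  ext a b
  simp [tensorPow, Matrix.star_apply]

theorem permOp_mul_apply (σ : Perm B) (X : Matrix (B → n) (B → n) ℂ) (a b : B → n) :
    (permOp n σ * X) a b = X (a ∘ σ) b := by
  simp [permOp, Matrix.mul_apply]

theorem permOp_mul (σ τ : Perm B) : permOp n (σ * τ) = permOp n σ * permOp n τ := by
  ext a b
  rw [permOp_mul_apply]
  simp only [permOp, Matrix.of_apply]
  rfl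

omit [Fintype n] [DecidableEq B] in
theorem permOp_one : permOp n (1 : Perm B) = 1 := by
  ext a b
  simp [permOp, Matrix.one_apply]

/-! ### Zariski density of the unitary group -/

omit [DecidableEq n] in
/-- Commuting with a tensor power is a polynomial condition: if it holds at infinitely many points
of a complex line of matrices, it holds on the whole line. -/
theorem commute_tensorPow_line {T : Matrix (B → n) (B → n) ℂ} (X Y : Matrix n n ℂ)
    {Z : Set ℂ} (hZ : Z.Infinite) (h : ∀ z ∈ Z, Commute T (tensorPow B (X + z • Y))) (z : ℂ) :
    Commute T (tensorPow B (X + z • Y)) := by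
  open Polynomial in
  let p : n → n → ℂ[X] := fun i j => C (X i j) + Polynomial.X * C (Y i j)
  let q : (B → n) → (B → n) → ℂ[X] := fun a b =>
    ∑ l, C (T a l) * ∏ j, p (l j) (b j) - ∑ l, (∏ j, p (a j) (l j)) * C (T l b)
  have hq : ∀ z a b, (q a b).eval z =
      (T * tensorPow B (X + z • Y)) a b - (tensorPow B (X + z • Y) * T) a b := by
    intro z a b
    simp [q, p, Matrix.mul_apply, tensorPow, Polynomial.eval_finsetSum, Polynomial.eval_prod,
      mul_comm z]
  have hq0 : ∀ a b, q a b = 0 := fun a b =>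
    Polynomial.eq_zero_of_infinite_isRoot _ (hZ.mono fun z hz => by
      have := congrFun (congrFun (h z hz).eq a) b
      simp [Polynomial.IsRoot, hq, this])
  ext a b
  have := hq z a b
  rw [hq0, Polynomial.eval_zero] at this
  exact (sub_eq_zero.1 this.symm)

theorem infinite_unit_circle : {z : ℂ | ‖z‖ = 1}.Infinite := by
  have h : Set.InjOn (fun t : ℝ => (t : ℂ) + Real.sqrt (1 - t ^ 2) * Complex.I) (Set.Icc 0 1) := by
    intro s _ t _ hst
    simpa using congrArg Complex.re hst
  refine ((Set.infinite_of_injOn_mapsTo h) ?_ (Set.Icc_infinite one_pos))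
  intro t ht
  have h1 : (0 : ℝ) ≤ 1 - t ^ 2 := by nlinarith [ht.1, ht.2]
  show ‖(t : ℂ) + Real.sqrt (1 - t ^ 2) * Complex.I‖ = 1
  rw [Complex.norm_add_mul_I, Real.sq_sqrt h1]
  simp

/-- Unitary diagonal matrices are Zariski dense among the diagonal matrices. -/
theorem commute_tensorPow_diagonal {T : Matrix (B → n) (B → n) ℂ}
    (h : ∀ V ∈ Matrix.unitaryGroup n ℂ, Commute T (tensorPow B V)) (z : n → ℂ) :
    Commute T (tensorPow B (Matrix.diagonal z)) := by
  suffices H : ∀ (s : Finset n) (z : n → ℂ), (∀ i ∉ s, ‖z i‖ = 1) →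
      Commute T (tensorPow B (Matrix.diagonal z)) from H Finset.univ z (by simp)
  intro s
  induction s using Finset.induction_on with
  | empty =>
    intro z hz
    refine h _ ?_
    rw [Matrix.mem_unitaryGroup_iff, Matrix.star_eq_conjTranspose, Matrix.diagonal_conjTranspose,
      Matrix.diagonal_mul_diagonal, ← Matrix.diagonal_one]
    congr 1
    funext i
    simp [Complex.mul_conj, Complex.normSq_eq_norm_sq, hz i]
  | insert i s hi ih =>
    intro z hz
    have key : ∀ x : ℂ, Matrix.diagonal (Function.update z i x) =
        Matrix.diagonal (Function.update z i 0) + x • Matrix.diagonal (Pi.single i 1) := by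
      intro x
      rw [← Matrix.diagonal_smul, Matrix.diagonal_add]
      congr 1
      funext j
      by_cases hj : j = i
      · subst hj; simp
      · simp [hj]
    have := commute_tensorPow_line (T := T) (Matrix.diagonal (Function.update z i 0))
      (Matrix.diagonal (Pi.single i 1)) infinite_unit_circle
      (fun x hx => by
        rw [← key]
        refine ih _ fun j hj => ?_
        by_cases hji : j = i
        · subst hji; simpa using hx
        · rw [Function.update_of_ne hji]
          exact hz j (by simp [hji, hj])) (z i)
    rwa [← key, Function.update_eq_self] at this

/-- The unitary group is Zariski dense in the full matrix algebra: a matrix commuting with all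
tensor powers of unitaries commutes with all tensor powers. Every matrix lies on a complex line
whose real points are Hermitian, and Hermitian matrices are unitarily diagonalizable. -/
theorem commute_tensorPow_of_unitary {T : Matrix (B → n) (B → n) ℂ}
    (h : ∀ V ∈ Matrix.unitaryGroup n ℂ, Commute T (tensorPow B V)) (X : Matrix n n ℂ) :
    Commute T (tensorPow B X) := by
  have herm : ∀ H : Matrix n n ℂ, H.IsHermitian → Commute T (tensorPow B H) := by
    intro H hH
    rw [hH.spectral_theorem, Unitary.conjStarAlgAut_apply, tensorPow_mul, tensorPow_mul]
    exact ((h _ hH.eigenvectorUnitary.2).mul_right (commute_tensorPow_diagonal h _)).mul_right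
      (h _ (star hH.eigenvectorUnitary).2)
  have hX := commute_tensorPow_line (T := T) (realPart X : Matrix n n ℂ)
    (imaginaryPart X : Matrix n n ℂ) (Z := Set.range ((↑) : ℝ → ℂ))
    (Set.infinite_range_of_injective Complex.ofReal_injective)
    (by
      rintro _ ⟨t, rfl⟩
      refine herm _ (IsSelfAdjoint.add (realPart X).2 ?_)
      exact IsSelfAdjoint.smul (by simp [isSelfAdjoint_iff]) (imaginaryPart X).2) Complex.I
  rwa [realPart_add_I_smul_imaginaryPart] at hX

/-! ### Polarization -/

theorem sum_sign_pow (m : ℕ) : ∑ u : ℤˣ, ((u : ℤ) : ℂ) ^ m = 1 + (-1) ^ m := by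
  have : (Finset.univ : Finset ℤˣ) = {1, -1} := by decide
  rw [this, Finset.sum_pair (by decide)]
  simp

/-- The signed sum over all choices of signs detects bijectivity of `f`: it factorizes over the
values `c`, and a fibre of `f` of even size makes the factor vanish. If `f` is not bijective, some
fibre is empty. -/
theorem sum_signs (f : B → B) :
    ∑ ε : B → ℤˣ, (∏ c, ((ε c : ℤ) : ℂ)) * ∏ j, ((ε (f j) : ℤ) : ℂ) =
      if Function.Bijective f then 2 ^ Fintype.card B else 0 := by
  have h1 : ∀ ε : B → ℤˣ, (∏ c, ((ε c : ℤ) : ℂ)) * ∏ j, ((ε (f j) : ℤ) : ℂ) =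
      ∏ c, ((ε c : ℤ) : ℂ) ^ (1 + (Finset.univ.filter fun j => f j = c).card) := by
    intro ε
    rw [← Finset.prod_fiberwise Finset.univ f (fun j => ((ε (f j) : ℤ) : ℂ)),
      ← Finset.prod_mul_distrib]
    refine Finset.prod_congr rfl fun c _ => ?_
    rw [pow_add, pow_one, Finset.prod_congr rfl (g := fun _ => ((ε c : ℤ) : ℂ)),
      Finset.prod_const]
    intro j hj
    rw [(Finset.mem_filter.1 hj).2]
  simp_rw [h1]
  rw [← Fintype.prod_sum (fun c (u : ℤˣ) =>
    ((u : ℤ) : ℂ) ^ (1 + (Finset.univ.filter fun j => f j = c).card))]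
  simp_rw [sum_sign_pow]
  split_ifs with hf
  · have : ∀ c, (Finset.univ.filter fun j => f j = c).card = 1 := by
      intro c
      obtain ⟨j, hj, hj'⟩ := hf.existsUnique c
      rw [Finset.card_eq_one]
      exact ⟨j, by ext i; simpa using ⟨fun h => hj' i h, fun h => h ▸ hj⟩⟩
    simp only [this]
    norm_num
  · have : ∃ c, ∀ j, f j ≠ c := by
      by_contra! hc
      exact hf (Finite.injective_iff_surjective.2 hc |> fun hi => ⟨hi, hc⟩)
    obtain ⟨c, hc⟩ := this
    refine Finset.prod_eq_zero (Finset.mem_univ c) ?_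
    simp [hc]

/-- The symmetrized tensor product of the matrices `X b`, `b ∈ B`. -/
def symTensor (X : B → Matrix n n ℂ) : Matrix (B → n) (B → n) ℂ :=
  Matrix.of fun a b => ∑ σ : Perm B, ∏ j, X (σ j) (a j) (b j)

omit [Fintype n] [DecidableEq n] in
/-- Polarization: symmetrized tensor products are combinations of tensor powers. -/
theorem sum_signs_tensorPow (X : B → Matrix n n ℂ) :
    ∑ ε : B → ℤˣ, (∏ c, ((ε c : ℤ) : ℂ)) • tensorPow B (∑ c, ((ε c : ℤ) : ℂ) • X c) =
      (2 : ℂ) ^ Fintype.card B • symTensor X := by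
  ext a b
  simp only [Matrix.sum_apply, Matrix.smul_apply, tensorPow, symTensor, Matrix.of_apply,
    smul_eq_mul, Fintype.prod_sum, Finset.prod_mul_distrib, Finset.mul_sum]
  rw [Finset.sum_comm]
  simp_rw [← mul_assoc, ← Finset.sum_mul, sum_signs, ite_mul, zero_mul]
  rw [← Finset.sum_filter]
  refine Finset.sum_bij (fun f hf => Equiv.ofBijective f (Finset.mem_filter.1 hf).2) (by simp)
    ?_ ?_ ?_
  · intro f _ g _ h
    funext j
    exact congrArg (fun e : Perm B => e j) h
  · intro σ _
    exact ⟨σ, by simp, by ext; simp⟩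
  · intro f _
    rfl

/-- Symmetric matrices are spanned by symmetrized tensors. -/
theorem factorial_smul_eq_sum_symTensor (M : Matrix (B → n) (B → n) ℂ)
    (hM : ∀ (σ : Perm B) a b, M (a ∘ σ) (b ∘ σ) = M a b) :
    (Fintype.card (Perm B) : ℂ) • M =
      ∑ i : B → n, ∑ l : B → n, M i l • symTensor fun c => Matrix.single (i c) (l c) (1 : ℂ) := by
  ext a b
  simp only [Matrix.sum_apply, Matrix.smul_apply, symTensor, Matrix.of_apply, smul_eq_mul,
    Matrix.single_apply, Finset.mul_sum]
  have h1 : ∀ (i l : B → n) (σ : Perm B),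
      M i l * ∏ j, (if i (σ j) = a j ∧ l (σ j) = b j then (1 : ℂ) else 0) =
        if i = a ∘ ⇑σ⁻¹ then (if l = b ∘ ⇑σ⁻¹ then M i l else 0) else 0 := by
    intro i l σ
    have e : ∀ p q : B → n, (∀ j, p (σ j) = q j) ↔ p = q ∘ ⇑σ⁻¹ := by
      intro p q
      constructor
      · intro h; funext j; simpa using h (σ⁻¹ j)
      · rintro rfl j; simp
    rw [Finset.prod_ite_zero]
    simp only [Finset.mem_univ, true_implies, Finset.prod_const_one, forall_and, e]
    rw [ite_and]
    split_ifs <;> simp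
  simp_rw [h1]
  have h2 : ∀ i : B → n, ∑ l : B → n, ∑ σ : Perm B,
      (if i = a ∘ ⇑σ⁻¹ then (if l = b ∘ ⇑σ⁻¹ then M i l else 0) else 0) =
      ∑ σ : Perm B, if i = a ∘ ⇑σ⁻¹ then M i (b ∘ ⇑σ⁻¹) else 0 := by
    intro i
    rw [Finset.sum_comm]
    refine Finset.sum_congr rfl fun σ _ => ?_
    split_ifs
    · simp
    · simp
  simp_rw [h2]
  rw [Finset.sum_comm]
  simp [hM]

/-- A matrix commuting with all tensor powers commutes with every matrix that is invariant under
permutations of the tensor factors. -/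
theorem commute_of_commute_tensorPow {T : Matrix (B → n) (B → n) ℂ}
    (h : ∀ X : Matrix n n ℂ, Commute T (tensorPow B X)) (M : Matrix (B → n) (B → n) ℂ)
    (hM : ∀ (σ : Perm B) a b, M (a ∘ σ) (b ∘ σ) = M a b) : Commute T M := by
  have h1 : ∀ X : B → Matrix n n ℂ, Commute T (symTensor X) := by
    intro X
    have : Commute T ((2 : ℂ) ^ Fintype.card B • symTensor X) := by
      rw [← sum_signs_tensorPow]
      exact Commute.sum_right _ _ _ fun ε _ => (h _).smul_right _
    simpa [smul_smul] using this.smul_right (((2 : ℂ) ^ Fintype.card B)⁻¹)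
  have h2 : Commute T ((Fintype.card (Perm B) : ℂ) • M) := by
    rw [factorial_smul_eq_sum_symTensor M hM]
    exact Commute.sum_right _ _ _ fun i _ => Commute.sum_right _ _ _ fun l _ =>
      (h1 _).smul_right _
  have h3 : (Fintype.card (Perm B) : ℂ) ≠ 0 := Nat.cast_ne_zero.2 Fintype.card_ne_zero
  simpa [smul_smul, h3] using h2.smul_right ((Fintype.card (Perm B) : ℂ)⁻¹)

/-! ### The double commutant argument -/

/-- A matrix commuting with all matrices invariant under permutations of the tensor factors is a
linear combination of permutation operators. Averaging a linear projection onto their span yields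
`q`, which commutes with left multiplication by permutation operators; its slices `M r s` are
invariant matrices, so `q T = T * q 1 = (#B)! • T`. -/
theorem mem_span_permOp {T : Matrix (B → n) (B → n) ℂ}
    (h : ∀ M : Matrix (B → n) (B → n) ℂ, (∀ (σ : Perm B) a b, M (a ∘ σ) (b ∘ σ) = M a b) →
      Commute T M) :
    T ∈ Submodule.span ℂ (Set.range (permOp n : Perm B → Matrix (B → n) (B → n) ℂ)) := by
  set 𝒜 := Submodule.span ℂ (Set.range (permOp n : Perm B → Matrix (B → n) (B → n) ℂ)) with h𝒜
  obtain ⟨p, hp⟩ := LinearMap.exists_leftInverse_of_injective 𝒜.subtype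
    (LinearMap.ker_eq_bot.2 𝒜.injective_subtype)
  have hmem : ∀ σ : Perm B, permOp n σ ∈ 𝒜 := fun σ => Submodule.subset_span ⟨σ, rfl⟩
  have hmul : ∀ (σ : Perm B) (X), X ∈ 𝒜 → permOp n σ * X ∈ 𝒜 := by
    intro σ X hX
    induction hX using Submodule.span_induction with
    | mem x hx => obtain ⟨τ, rfl⟩ := hx; rw [← permOp_mul]; exact hmem _
    | zero => simp
    | add x y _ _ hx hy => rw [mul_add]; exact add_mem hx hy
    | smul c x _ hx => rw [mul_smul_comm]; exact 𝒜.smul_mem _ hx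
  let q : Matrix (B → n) (B → n) ℂ →ₗ[ℂ] Matrix (B → n) (B → n) ℂ :=
    ∑ σ : Perm B, LinearMap.mulLeft ℂ (permOp n σ⁻¹) ∘ₗ 𝒜.subtype ∘ₗ p ∘ₗ
      LinearMap.mulLeft ℂ (permOp n σ)
  have hq : ∀ X, q X = ∑ σ : Perm B, permOp n σ⁻¹ * (p (permOp n σ * X) : Matrix _ _ ℂ) := by
    intro X; simp [q, LinearMap.sum_apply]
  have hqmem : ∀ X, q X ∈ 𝒜 := fun X => by
    rw [hq]; exact Submodule.sum_mem _ fun σ _ => hmul _ _ (p _).2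
  have hq1 : q 1 = (Fintype.card (Perm B) : ℂ) • 1 := by
    rw [hq]
    have : ∀ σ : Perm B, (p (permOp n σ * 1) : Matrix _ _ ℂ) = permOp n σ := by
      intro σ
      have := LinearMap.congr_fun hp ⟨permOp n σ, hmem σ⟩
      simpa using congrArg Subtype.val this
    simp_rw [this, ← permOp_mul, inv_mul_cancel, permOp_one]
    simp [← Nat.cast_smul_eq_nsmul ℂ]
  have hqmul : ∀ (π : Perm B) X, q (permOp n π * X) = permOp n π * q X := by
    intro π X
    rw [hq, hq, Finset.mul_sum, ← Equiv.sum_comp (Equiv.mulRight π⁻¹)]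
    refine Finset.sum_congr rfl fun σ _ => ?_
    rw [← mul_assoc, ← mul_assoc, ← permOp_mul, ← permOp_mul]
    simp
  let M : (B → n) → (B → n) → Matrix (B → n) (B → n) ℂ := fun r s =>
    Matrix.of fun a b => q (Matrix.single b r 1) a s
  have hM : ∀ r s, Commute T (M r s) := by
    intro r s
    refine h _ fun π a b => ?_
    have e : permOp n π * Matrix.single (b ∘ π) r (1 : ℂ) = Matrix.single b r 1 := by
      ext c d
      rw [permOp_mul_apply]
      have : b ∘ π = c ∘ π ↔ b = c := π.surjective.injective_comp_right.eq_iff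
      simp [Matrix.single_apply, this]
    change q (Matrix.single (b ∘ π) r 1) (a ∘ π) s = q (Matrix.single b r 1) a s
    rw [← e, hqmul, permOp_mul_apply]
  have hslice : ∀ X a s, q X a s = ∑ r, (M r s * X) a r := by
    intro X a s
    conv_lhs => rw [Matrix.matrix_eq_sum_single X]
    rw [map_sum, Matrix.sum_apply]
    simp only [map_sum, Matrix.sum_apply, Matrix.mul_apply, M, Matrix.of_apply]
    rw [Finset.sum_comm]
    refine Finset.sum_congr rfl fun r _ => Finset.sum_congr rfl fun b _ => ?_
    have : Matrix.single b r (X b r) = X b r • Matrix.single b r (1 : ℂ) := by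
      rw [Matrix.smul_single, smul_eq_mul, mul_one]
    rw [this, map_smul, Matrix.smul_apply, smul_eq_mul, mul_comm]
  have hqT : q T = T * q 1 := by
    ext a s
    rw [hslice, Matrix.mul_apply]
    simp_rw [fun r => ((hM r s).eq).symm, Matrix.mul_apply]
    rw [Finset.sum_comm]
    refine Finset.sum_congr rfl fun l _ => ?_
    rw [← Finset.mul_sum, hslice]
    simp
  rw [hq1, mul_smul_comm, mul_one] at hqT
  have h3 : (Fintype.card (Perm B) : ℂ) ≠ 0 := Nat.cast_ne_zero.2 Fintype.card_ne_zero
  have := 𝒜.smul_mem ((Fintype.card (Perm B) : ℂ)⁻¹) (hqmem T)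
  rwa [hqT, smul_smul, inv_mul_cancel₀ h3, one_smul] at this

/-- Schur–Weyl duality for the unitary group: a matrix commuting with all `V^{⊗ B}`, `V` unitary,
is a linear combination of permutation operators. -/
theorem exists_eq_sum_permOp {T : Matrix (B → n) (B → n) ℂ}
    (h : ∀ V ∈ Matrix.unitaryGroup n ℂ, Commute T (tensorPow B V)) :
    ∃ x : Perm B → ℂ, T = ∑ σ, x σ • permOp n σ := by
  have := mem_span_permOp (commute_of_commute_tensorPow (commute_tensorPow_of_unitary h))
  rw [Submodule.mem_span_range_iff_exists_fun] at this
  obtain ⟨x, hx⟩ := this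
  exact ⟨x, hx.symm⟩

end SchurWeyl

/-! ### Counting functions that are constant along cycles -/

/-- The number of functions constant along the cycles of `σ`. -/
theorem sum_comp_perm_eq {α β : Type*} [Fintype α] [DecidableEq α] [Fintype β] [DecidableEq β]
    (σ : Perm α) :
    ∑ c : α → β, (if c ∘ σ = c then (1 : ℂ) else 0) = (Fintype.card β : ℂ) ^ numCycles σ := by
  classical
  have hinv : ∀ c : α → β, c ∘ σ = c → ∀ x y, σ.SameCycle x y → c x = c y := by
    rintro c hc x _ ⟨m, rfl⟩
    have h1 : ∀ x, c (σ x) = c x := congrFun hc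
    induction m using Int.induction_on with
    | zero => simp
    | succ m ih => rw [add_comm, zpow_add, zpow_one, Perm.mul_apply, h1]; exact ih
    | pred m ih =>
      rw [ih, ← h1 ((σ ^ (-(m : ℤ) - 1)) x), ← Perm.mul_apply, ← zpow_one_add]
      congr 3; ring
  let e : {c : α → β // c ∘ σ = c} ≃ (Quotient (Perm.SameCycle.setoid σ) → β) :=
    { toFun := fun c => Quotient.lift c.1 (hinv c.1 c.2)
      invFun := fun f => ⟨fun x => f (Quotient.mk _ x), by
        funext x
        exact congrArg f (Quotient.sound (s := Perm.SameCycle.setoid σ) ⟨-1, by simp⟩)⟩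
      left_inv := fun c => rfl
      right_inv := fun f => by
        funext x
        induction x using Quotient.inductionOn
        rfl }
  have h2 : Fintype.card {c : α → β // c ∘ σ = c} = Fintype.card β ^ numCycles σ := by
    rw [Fintype.card_congr e, Fintype.card_fun, numCycles, Nat.card_eq_fintype_card]
  rw [Finset.sum_boole, ← Fintype.card_subtype, h2, Nat.cast_pow]

theorem numCycles_inv {α : Type*} (σ : Perm α) : numCycles σ⁻¹ = numCycles σ := by
  have : Perm.SameCycle.setoid σ⁻¹ = Perm.SameCycle.setoid σ := by
    ext x y
    exact Perm.sameCycle_inv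
  rw [numCycles, numCycles, this]

/-! ### The Weingarten matrix as a generalized inverse of the Gram matrix -/

section Weingarten

variable {B : Type*} [Fintype B] [DecidableEq B]

omit [Fintype B] [DecidableEq B] in
theorem gramMatrix_symm (d : ℕ) (σ τ : Perm B) :
    gramMatrix B d σ τ = gramMatrix B d τ σ := by
  simp only [gramMatrix, Matrix.of_apply]
  rw [← numCycles_inv, mul_inv_rev, inv_inv]

omit [Fintype B] [DecidableEq B] in
theorem gramMatrix_mul_left (d : ℕ) (π σ τ : Perm B) :
    gramMatrix B d (π * σ) (π * τ) = gramMatrix B d σ τ := by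
  simp [gramMatrix, mul_assoc]

omit [Fintype B] [DecidableEq B] in
theorem gramMatrix_isSelfAdjoint (d : ℕ) : IsSelfAdjoint (gramMatrix B d) := by
  ext σ τ
  rw [Matrix.star_apply, gramMatrix_symm]
  simp [gramMatrix]

/-- The Weingarten matrix is a generalized inverse of the Gram matrix, in every dimension `d`: on the
spectrum, `x * x⁻¹ * x = x` holds also at `x = 0`. -/
theorem gram_mul_weingarten_mul_gram (d : ℕ) :
    gramMatrix B d * weingartenMatrix B d * gramMatrix B d = gramMatrix B d := by
  have hG := gramMatrix_isSelfAdjoint (B := B) d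
  have hc : ∀ f : ℝ → ℝ, ContinuousOn f (spectrum ℝ (gramMatrix B d)) := fun f =>
    (Matrix.finite_real_spectrum).continuousOn f
  have h1 : cfc (fun x : ℝ => x) (gramMatrix B d) = gramMatrix B d := cfc_id' ℝ _
  rw [weingartenMatrix]
  nth_rw 1 [← h1]
  rw [← cfc_mul _ _ _ (hc _) (hc _)]
  nth_rw 2 [← h1]
  rw [← cfc_mul _ _ _ (hc _) (hc _)]
  conv_rhs => rw [← h1]
  congr 1
  funext x
  by_cases hx : x = 0 <;> simp [hx]

/-- The Weingarten matrix commutes with left translations, since the Gram matrix does. -/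
theorem weingartenMatrix_eq_Wg (d : ℕ) (σ τ : Perm B) :
    weingartenMatrix B d σ τ = Wg (σ⁻¹ * τ) d := by
  let L : Matrix (Perm B) (Perm B) ℂ := Matrix.of fun a b => if σ * a = b then 1 else 0
  have hL : ∀ (X : Matrix (Perm B) (Perm B) ℂ) a b, (L * X) a b = X (σ * a) b := by
    intro X a b; simp [L, Matrix.mul_apply]
  have hR : ∀ (X : Matrix (Perm B) (Perm B) ℂ) a b, (X * L) a b = X a (σ⁻¹ * b) := by
    intro X a b
    have : ∀ c, σ * c = b ↔ c = σ⁻¹ * b := fun c => eq_inv_mul_iff_mul_eq.symm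
    simp [L, Matrix.mul_apply, this]
  have h : Commute (gramMatrix B d) L := by
    ext a b
    rw [hL, hR, ← gramMatrix_mul_left d σ, mul_inv_cancel_left]
  have h' := h.cfc_real (fun x : ℝ => x⁻¹)
  have h'' := congrFun (congrFun h'.eq 1) τ
  rw [hL, hR, mul_one] at h''
  exact h''.symm

theorem gram_mul_Wg_mul_gram (d : ℕ) :
    gramMatrix B d * (Matrix.of fun σ τ => Wg (σ⁻¹ * τ) d) * gramMatrix B d = gramMatrix B d := by
  convert! gram_mul_weingarten_mul_gram (B := B) d using 3
  ext σ τ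
  exact (weingartenMatrix_eq_Wg d σ τ).symm

variable {n : Type*} [Fintype n] [DecidableEq n]

/-- The Gram matrix consists of the inner products of the permutation operators. -/
theorem sum_permOp_eq_gram (σ τ : Perm B) :
    ∑ a : B → n, permOp n σ a (a ∘ τ) = gramMatrix B (Fintype.card n) σ τ := by
  rw [gramMatrix, Matrix.of_apply, ← sum_comp_perm_eq (β := n),
    ← Equiv.sum_comp (σ.arrowCongr (Equiv.refl n))]
  refine Finset.sum_congr rfl fun a _ => ?_
  simp only [permOp, Matrix.of_apply]
  congr 1
  rw [eq_iff_iff]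
  constructor
  · intro h
    funext j
    have := congrFun h j
    simpa using this.symm
  · intro h
    funext j
    have := congrFun h j
    simpa using this.symm

/-- Coefficients in the kernel of the Gram matrix give the zero operator. -/
theorem sum_permOp_eq_zero {z : Perm B → ℂ}
    (hz : Matrix.vecMul z (gramMatrix B (Fintype.card n)) = 0) :
    ∑ σ, z σ • permOp n σ = 0 := by
  set S := ∑ σ, z σ • permOp n σ with hS
  have h1 : ∀ τ : Perm B, ∑ a : B → n, S a (a ∘ τ) = 0 := by
    intro τ
    have := congrFun hz τ
    simp only [Matrix.vecMul, dotProduct, Pi.zero_apply, ← sum_permOp_eq_gram (n := n)] at this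
    simp only [hS, Matrix.sum_apply, Matrix.smul_apply, smul_eq_mul]
    rw [Finset.sum_comm, ← this]
    simp [Finset.mul_sum]
  have h2 : ∑ a, ∑ b, S a b * star (S a b) = 0 := by
    have : ∀ a b, S a b * star (S a b) =
        ∑ τ, star (z τ) * (if a ∘ τ = b then S a b else 0) := by
      intro a b
      have hab : star (S a b) = ∑ τ, star ((z τ • permOp n τ) a b) := by
        rw [hS, Matrix.sum_apply, star_sum]
      rw [hab, Finset.mul_sum]
      refine Finset.sum_congr rfl fun τ _ => ?_
      simp only [Matrix.smul_apply, permOp, Matrix.of_apply]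
      split_ifs <;> simp [mul_comm]
    simp_rw [this]
    have h3 : ∀ a : B → n, ∑ b, ∑ τ, star (z τ) * (if a ∘ τ = b then S a b else 0) =
        ∑ τ : Perm B, star (z τ) * S a (a ∘ τ) := by
      intro a
      rw [Finset.sum_comm]
      simp
    simp_rw [h3]
    rw [Finset.sum_comm]
    simp [← Finset.mul_sum, h1]
  have h4 : ∑ a, ∑ b, Complex.normSq (S a b) = 0 := by
    have : ((∑ a, ∑ b, Complex.normSq (S a b) : ℝ) : ℂ) = 0 := by
      rw [← h2]
      push_cast
      simp [← Complex.mul_conj]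
    exact_mod_cast this
  have h5 := (Finset.sum_eq_zero_iff_of_nonneg
    fun a _ => Finset.sum_nonneg fun b _ => Complex.normSq_nonneg _).1 h4
  ext a b
  have h6 := (Finset.sum_eq_zero_iff_of_nonneg fun b _ => Complex.normSq_nonneg _).1
    (h5 a (Finset.mem_univ a)) b (Finset.mem_univ b)
  exact Complex.normSq_eq_zero.1 h6

/-- A combination of permutation operators is recovered from its inner products with the
permutation operators through the Weingarten function. -/
theorem eq_sum_Wg_of_mem_span {T : Matrix (B → n) (B → n) ℂ} {x : Perm B → ℂ}
    (hT : T = ∑ σ, x σ • permOp n σ) :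
    T = ∑ σ : Perm B, ∑ τ : Perm B, (Wg (σ⁻¹ * τ) (Fintype.card n) * ∑ a, T a (a ∘ σ)) •
      permOp n τ := by
  set G := gramMatrix B (Fintype.card n)
  set W : Matrix (Perm B) (Perm B) ℂ := Matrix.of fun σ τ => Wg (σ⁻¹ * τ) (Fintype.card n) with hW
  have h1 : ∀ σ : Perm B, ∑ a : B → n, T a (a ∘ σ) = Matrix.vecMul x G σ := by
    intro σ
    simp only [hT, Matrix.sum_apply, Matrix.smul_apply, smul_eq_mul, Matrix.vecMul, dotProduct]
    rw [Finset.sum_comm]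
    simp only [← Finset.mul_sum, sum_permOp_eq_gram]
    rfl
  have h2 : ∑ σ : Perm B, ∑ τ : Perm B, (Wg (σ⁻¹ * τ) (Fintype.card n) * ∑ a, T a (a ∘ σ)) •
      permOp n τ = ∑ τ, (Matrix.vecMul (Matrix.vecMul x G) W τ) • permOp n τ := by
    rw [Finset.sum_comm]
    refine Finset.sum_congr rfl fun τ _ => ?_
    rw [← Finset.sum_smul]
    congr 1
    simp only [h1]
    conv_rhs => rw [Matrix.vecMul, dotProduct]
    exact Finset.sum_congr rfl fun σ _ => mul_comm _ _
  rw [h2, hT, ← sub_eq_zero, ← Finset.sum_sub_distrib]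
  simp_rw [← sub_smul]
  -- `(x - x G W) G = 0` because `G W G = G`.
  have := sum_permOp_eq_zero (n := n) (z := x - Matrix.vecMul (Matrix.vecMul x G) W) (by
    rw [Matrix.sub_vecMul, Matrix.vecMul_vecMul, Matrix.vecMul_vecMul, ← mul_assoc,
      gram_mul_Wg_mul_gram, sub_self])
  exact this

end Weingarten

/-! ### Moments of Haar unitaries -/

section Moments

variable {B n G : Type*} [Fintype B] [DecidableEq B] [Fintype n] [DecidableEq n]

/-- A product of entries of `φ` and of complex conjugates of such entries. It is the matrix entry at
`(a, a')` of `φ^{⊗ B} E (φ^{⊗ B})*`, where `E` is the matrix unit at `(b, c)`. -/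
def entryProd (φ : Matrix n n ℂ) (a b a' c : B → n) : ℂ :=
  ∏ j, φ (a j) (b j) * star (φ (a' j) (c j))

omit [DecidableEq B] in
theorem norm_entryProd_le {φ : Matrix n n ℂ} (hφ : φ ∈ Matrix.unitaryGroup n ℂ)
    (a b a' c : B → n) : ‖entryProd φ a b a' c‖ ≤ 1 := by
  rw [entryProd, norm_prod]
  refine Finset.prod_le_one (fun _ _ => norm_nonneg _) fun j _ => ?_
  rw [norm_mul, norm_star]
  exact mul_le_one₀ (entry_norm_bound_of_unitary hφ _ _) (norm_nonneg _)
    (entry_norm_bound_of_unitary hφ _ _)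

omit [DecidableEq B] [Fintype n] [DecidableEq n] in
theorem measurable_entryProd [MeasurableSpace G] {φ : G → Matrix n n ℂ}
    (hφ : ∀ i j, Measurable fun g => φ g i j) (a b a' c : B → n) :
    Measurable fun g => entryProd (φ g) a b a' c := by
  unfold entryProd
  exact Finset.measurable_prod _ fun j _ =>
    (hφ _ _).mul (continuous_star.measurable.comp (hφ _ _))

omit [DecidableEq B] in
theorem integrable_entryProd [MeasurableSpace G] (μ : Measure G) [IsFiniteMeasure μ]
    {φ : G → Matrix n n ℂ} (hφ : ∀ i j, Measurable fun g => φ g i j)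
    (hu : ∀ g, φ g ∈ Matrix.unitaryGroup n ℂ) (a b a' c : B → n) :
    Integrable (fun g => entryProd (φ g) a b a' c) μ :=
  Integrable.of_bound (measurable_entryProd hφ a b a' c).aestronglyMeasurable 1
    (Filter.Eventually.of_forall fun g => norm_entryProd_le (hu g) _ _ _ _)

omit [DecidableEq n] in
theorem entryProd_mul (V φ : Matrix n n ℂ) (a b a' c : B → n) :
    entryProd (V * φ) a b a' c = ∑ l : B → n, ∑ l' : B → n,
      tensorPow B V a l * entryProd φ l b l' c * star (tensorPow B V a' l') := by
  have h : ∀ l l' : B → n,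
      tensorPow B V a l * entryProd φ l b l' c * star (tensorPow B V a' l') =
      (∏ j, V (a j) (l j) * φ (l j) (b j)) * ∏ j, star (V (a' j) (l' j)) * star (φ (l' j) (c j)) := by
    intro l l'
    simp only [tensorPow, entryProd, Matrix.of_apply, star_prod, Finset.prod_mul_distrib]
    ring
  simp_rw [h, ← Finset.mul_sum, ← Finset.sum_mul]
  rw [← Fintype.prod_sum (fun j x => V (a j) x * φ x (b j)),
    ← Fintype.prod_sum (fun j x => star (V (a' j) x) * star (φ x (c j))), entryProd,
    ← Finset.prod_mul_distrib]
  refine Finset.prod_congr rfl fun j _ => ?_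
  simp only [Matrix.mul_apply, star_sum, star_mul']

/-- The inner product with `permOp n σ` does not depend on the unitary `φ`. -/
theorem sum_entryProd_comp {φ : Matrix n n ℂ} (hφ : φ ∈ Matrix.unitaryGroup n ℂ)
    (b c : B → n) (σ : Perm B) :
    ∑ a : B → n, entryProd φ a b (a ∘ σ) c = if b ∘ σ = c then 1 else 0 := by
  have h1 : ∀ a : B → n, entryProd φ a b (a ∘ σ) c =
      ∏ j, star (φ (a j) (c (σ⁻¹ j))) * φ (a j) (b j) := by
    intro a
    simp only [entryProd, Finset.prod_mul_distrib, Function.comp_apply]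
    rw [mul_comm]
    congr 1
    rw [← Equiv.prod_comp σ (fun j => star (φ (a j) (c (σ⁻¹ j))))]
    simp
  simp_rw [h1]
  rw [← Fintype.prod_sum (fun j x => star (φ x (c (σ⁻¹ j))) * φ x (b j))]
  have h2 : ∀ p q : n, ∑ x, star (φ x p) * φ x q = if p = q then 1 else 0 := by
    intro p q
    have := congrFun (congrFun (Matrix.mem_unitaryGroup_iff'.1 hφ) p) q
    simpa [Matrix.mul_apply, Matrix.one_apply] using this
  simp_rw [h2, Finset.prod_ite_zero]
  simp only [Finset.mem_univ, true_implies, Finset.prod_const_one]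
  congr 1
  rw [eq_iff_iff]
  constructor
  · intro h; funext j; simpa using (h (σ j)).symm
  · rintro rfl j; simp

/-- The Weingarten formula for the mixed moments of the entries of a Haar unitary, given as the
image of a left invariant probability measure under a homomorphism onto the unitary group.
Left invariance puts the matrix of moments into the commutant of the `V^{⊗ B}`. -/
theorem integral_entryProd [Group G] [MeasurableSpace G] [MeasurableMul G] (μ : Measure G)
    [IsProbabilityMeasure μ] [μ.IsMulLeftInvariant] (φ : G →* Matrix n n ℂ)
    (hφ : ∀ i j, Measurable fun g => φ g i j) (hu : ∀ g, φ g ∈ Matrix.unitaryGroup n ℂ)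
    (hs : ∀ V ∈ Matrix.unitaryGroup n ℂ, ∃ g, φ g = V) (a b a' c : B → n) :
    ∫ g, entryProd (φ g) a b a' c ∂μ = ∑ σ : Perm B, ∑ τ : Perm B,
      Wg (σ⁻¹ * τ) (Fintype.card n) * (if b ∘ σ = c then 1 else 0) *
        (if a ∘ τ = a' then 1 else 0) := by
  have hint := integrable_entryProd (B := B) μ hφ hu
  set T : Matrix (B → n) (B → n) ℂ := Matrix.of fun a a' => ∫ g, entryProd (φ g) a b a' c ∂μ
    with hT
  have hcomm : ∀ V ∈ Matrix.unitaryGroup n ℂ, Commute T (tensorPow B V) := by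
    intro V hV
    obtain ⟨h, rfl⟩ := hs V hV
    -- Replacing `g` by `h * g` under the integral conjugates `T` by `(φ h)^{⊗ B}`.
    have h1 : T = tensorPow B (φ h) * T * star (tensorPow B (φ h)) := by
      ext a a'
      simp only [hT, Matrix.of_apply]
      rw [← integral_mul_left_eq_self _ h]
      simp_rw [map_mul, entryProd_mul]
      rw [integral_finsetSum _ fun l _ => integrable_finsetSum _ fun l' _ =>
        ((hint _ _ _ _).const_mul _).mul_const _]
      simp_rw [Matrix.mul_apply, Finset.sum_mul]
      rw [Finset.sum_comm]
      refine Finset.sum_congr rfl fun l _ => ?_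
      rw [integral_finsetSum _ fun l' _ => ((hint _ _ _ _).const_mul _).mul_const _]
      refine Finset.sum_congr rfl fun l' _ => ?_
      rw [integral_mul_const, integral_const_mul]
      rfl
    have h2 : star (tensorPow B (φ h)) * tensorPow B (φ h) = 1 := by
      rw [← tensorPow_star, ← tensorPow_mul, Matrix.mem_unitaryGroup_iff'.1 hV, tensorPow_one]
    calc T * tensorPow B (φ h)
        = tensorPow B (φ h) * T * (star (tensorPow B (φ h)) * tensorPow B (φ h)) := by
          conv_lhs => rw [h1]
          rw [mul_assoc]
      _ = tensorPow B (φ h) * T := by rw [h2, mul_one]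
  obtain ⟨x, hx⟩ := exists_eq_sum_permOp hcomm
  have h3 : ∀ σ : Perm B, ∑ a, T a (a ∘ σ) = if b ∘ σ = c then 1 else 0 := by
    intro σ
    simp only [hT, Matrix.of_apply]
    rw [← integral_finsetSum _ fun a _ => hint _ _ _ _]
    simp_rw [fun g => sum_entryProd_comp (hu g) b c σ]
    simp
  have h4 := congrFun (congrFun (eq_sum_Wg_of_mem_span hx) a) a'
  simp only [h3, Matrix.sum_apply, Matrix.smul_apply, smul_eq_mul] at h4
  exact h4

end Moments

/-! ### Traces as sums over closed index paths -/

section Traces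

variable {n : Type*} [Fintype n] [DecidableEq n]

/-- An entry of a product is the sum over index paths from `a` to `b`. -/
theorem ofFn_prod_apply {k : ℕ} (M : Fin k → Matrix n n ℂ) (a b : n) :
    (List.ofFn M).prod a b = ∑ p : Fin (k + 1) → n,
      (if p 0 = a ∧ p (Fin.last k) = b then ∏ j, M j (p j.castSucc) (p j.succ) else 0) := by
  induction k generalizing a with
  | zero =>
    rw [← Equiv.sum_comp (Equiv.funUnique (Fin 1) n).symm]
    simp [Matrix.one_apply, ite_and]
  | succ k ih =>
    rw [List.ofFn_succ, List.prod_cons, Matrix.mul_apply,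
      ← Equiv.sum_comp (Fin.consEquiv fun _ : Fin (k + 2) => n), Fintype.sum_prod_type]
    simp_rw [ih, Finset.mul_sum]
    rw [Finset.sum_comm, Finset.sum_comm (γ := n)]
    refine Finset.sum_congr rfl fun p _ => ?_
    have h : ∀ x, Fin.consEquiv (fun _ : Fin (k + 2) => n) (x, p) = Fin.cons x p := fun _ => rfl
    simp only [h, ← Fin.succ_last, Fin.cons_succ, Fin.cons_zero, Fin.prod_univ_succ,
      Fin.castSucc_zero, ← Fin.succ_castSucc, ite_and, mul_ite, mul_zero]
    simp

/-- The trace of a product is the sum over closed index paths. -/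
theorem trace_ofFn_prod {k : ℕ} (hk : 0 < k) (M : Fin k → Matrix n n ℂ) :
    (List.ofFn M).prod.trace = ∑ p : Fin k → n, ∏ j, M j (p j) (p (finRotate k j)) := by
  obtain ⟨m, rfl⟩ : ∃ m, k = m + 1 := ⟨k - 1, by omega⟩
  simp only [Matrix.trace, Matrix.diag, ofFn_prod_apply]
  rw [Finset.sum_comm, ← Equiv.sum_comp (Fin.snocEquiv fun _ : Fin (m + 2) => n),
    Fintype.sum_prod_type, Finset.sum_comm]
  refine Finset.sum_congr rfl fun p _ => ?_
  have h : ∀ x, (Fin.snocEquiv (fun _ : Fin (m + 2) => n) (x, p) : Fin (m + 2) → n) =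
    Fin.snoc p x := fun _ => rfl
  simp only [h, Fin.snoc_last, ite_and]
  have h0 : ∀ x : n, (Fin.snoc p x : Fin (m + 2) → n) 0 = p 0 := fun x =>
    Fin.snoc_castSucc (α := fun _ => n) x p 0
  simp only [h0]
  rw [Finset.sum_eq_single (p 0)]
  · simp only [if_true, Finset.sum_ite_eq, Finset.mem_univ]
    refine Finset.prod_congr rfl fun j _ => ?_
    rw [Fin.snoc_castSucc (α := fun _ => n)]
    congr 1
    induction j using Fin.lastCases with
    | last => rw [finRotate_last, Fin.succ_last, Fin.snoc_last]
    | cast i =>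
      rw [Fin.succ_castSucc, Fin.snoc_castSucc (α := fun _ => n), finRotate_apply,
        Fin.coeSucc_eq_succ]
  · intro x _ hx
    simp [hx]
  · simp

variable {α : Type*} [Fintype α] [DecidableEq α]

/-- The points of `α`, listed cycle by cycle of `σ`, each cycle starting at its representative. -/
def cycleEquiv (σ : Perm α) :
    (Σ c : Quotient (Perm.SameCycle.setoid σ), Fin (Function.minimalPeriod σ c.out)) ≃ α :=
  Equiv.ofBijective (fun x => (σ ^ (x.2 : ℕ)) x.1.out) (by
    constructor
    · rintro ⟨c, m⟩ ⟨c', m'⟩ h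
      have hc : c = c' := by
        rw [← Quotient.out_eq c, ← Quotient.out_eq c']
        refine Quotient.sound (s := Perm.SameCycle.setoid σ) ?_
        have h1 : σ.SameCycle c.out ((σ ^ (m : ℕ)) c.out) := ⟨m, by simp⟩
        have h2 : σ.SameCycle c'.out ((σ ^ (m' : ℕ)) c'.out) := ⟨m', by simp⟩
        exact h1.trans ((congrArg (σ.SameCycle _) h).mp (Perm.SameCycle.refl _ _) |>.trans h2.symm)
      subst hc
      simp only [← Perm.iterate_eq_pow] at h
      rw [Function.iterate_eq_iterate_iff_of_lt_minimalPeriod m.2 m'.2] at h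
      rw [Fin.ext h]
    · intro x
      have h : σ.SameCycle (Quotient.mk (Perm.SameCycle.setoid σ) x).out x :=
        Quotient.exact (s := Perm.SameCycle.setoid σ) (Quotient.out_eq _)
      obtain ⟨m, hm⟩ := h.exists_nat_pow_eq
      refine ⟨⟨Quotient.mk _ x, ⟨m % Function.minimalPeriod σ _, Nat.mod_lt _ ?_⟩⟩, ?_⟩
      · exact Function.minimalPeriod_pos_of_mem_periodicPts
          (Function.Injective.mem_periodicPts σ.injective _)
      · simp only [← Perm.iterate_eq_pow] at hm ⊢
        rw [Function.iterate_mod_minimalPeriod_eq, hm])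

omit [DecidableEq α] in
theorem apply_cycleEquiv (σ : Perm α) (c : Quotient (Perm.SameCycle.setoid σ))
    (m : Fin (Function.minimalPeriod σ c.out)) :
    σ (cycleEquiv σ ⟨c, m⟩) = cycleEquiv σ ⟨c, finRotate _ m⟩ := by
  change σ ((σ ^ (m : ℕ)) c.out) = (σ ^ (finRotate _ m : ℕ)) c.out
  simp only [← Perm.iterate_eq_pow]
  rw [← Function.iterate_succ_apply' σ]
  generalize hp : Function.minimalPeriod σ c.out = p at m
  obtain ⟨q, rfl⟩ : ∃ q, p = q + 1 := ⟨p - 1, by have := m.2; omega⟩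
  induction m using Fin.lastCases with
  | last =>
    rw [finRotate_last]
    change σ^[q + 1] c.out = c.out
    rw [← hp, Function.iterate_minimalPeriod]
  | cast i =>
    rw [finRotate_apply, Fin.coeSucc_eq_succ]
    rfl

/-- The sum over all index assignments factorizes into traces along the cycles of `σ`. -/
theorem sum_prod_perm_eq_trPerm [Nonempty n] (σ : Perm α) (A : α → Matrix n n ℂ) :
    ∑ c : α → n, ∏ a, A a (c a) (c (σ a)) =
      (Fintype.card n : ℂ) ^ numCycles σ * trPerm σ A := by
  classical
  have h1 : ∀ c : Quotient (Perm.SameCycle.setoid σ),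
      ∑ p : Fin (Function.minimalPeriod σ c.out) → n,
        ∏ m, A (cycleEquiv σ ⟨c, m⟩) (p m) (p (finRotate _ m)) =
      (Fintype.card n : ℂ) * ntr (cycleProd σ A c.out) := by
    intro c
    rw [← trace_ofFn_prod (Function.minimalPeriod_pos_of_mem_periodicPts
          (Function.Injective.mem_periodicPts σ.injective _)), ntr,
      mul_inv_cancel_left₀ (Nat.cast_ne_zero.2 Fintype.card_ne_zero), cycleProd,
      ← List.map_coe_finRange_eq_range, List.map_map, List.ofFn_eq_map]
    rfl
  rw [trPerm, finprod_eq_prod_of_fintype, numCycles, Nat.card_eq_fintype_card,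
    ← Finset.card_univ (α := Quotient (Perm.SameCycle.setoid σ)), ← Finset.prod_const, ← Finset.prod_mul_distrib]
  simp_rw [← h1]
  rw [Fintype.prod_sum, ← Equiv.sum_comp (((cycleEquiv σ).arrowCongr (Equiv.refl n)).symm.trans
    (Equiv.piCurry fun _ _ => n))]
  refine Finset.sum_congr rfl fun f _ => ?_
  rw [← Equiv.prod_comp (cycleEquiv σ), Fintype.prod_sigma]
  refine Finset.prod_congr rfl fun c _ => Finset.prod_congr rfl fun m _ => ?_
  rw [apply_cycleEquiv]
  rfl

end Traces

/-! ### Index sums for a fixed pair of permutations -/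

section IndexSums

variable {S I : Type*} [Fintype S] [DecidableEq S] {K : I → Finset S} {N k : ℕ} {w : Fin k → I}

/-- Index assignments on the pairs `(j, s)` with `s ∈ K (w j)`. -/
abbrev InnerIndex (K : I → Finset S) (N : ℕ) (w : Fin k → I) : Type _ :=
  ∀ s : S, {j // s ∈ K (w j)} → Fin N

/-- Index assignments on the pairs `(j, s)` with `s ∉ K (w j)`. -/
abbrev OuterIndex (K : I → Finset S) (N : ℕ) (w : Fin k → I) : Type _ :=
  ∀ s : S, {j // s ∉ K (w j)} → Fin N

/-- An index assignment on all pairs `(j, s)` splits into its inner and outer parts. -/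
def glue : InnerIndex K N w × OuterIndex K N w ≃ (Fin k → S → Fin N) where
  toFun z j s := if h : s ∈ K (w j) then z.1 s ⟨j, h⟩ else z.2 s ⟨j, h⟩
  invFun b := ⟨fun s j => b j s, fun s j => b j s⟩
  left_inv z := by
    refine Prod.ext ?_ ?_
    · funext s j; simp [j.2]
    · funext s j; simp [j.2]
  right_inv b := by
    funext j s
    by_cases h : s ∈ K (w j) <;> simp [h]

omit [Fintype S] in
theorem glue_inner (z : InnerIndex K N w × OuterIndex K N w) {j : Fin k} {s : S}
    (h : s ∈ K (w j)) : glue z j s = z.1 s ⟨j, h⟩ := by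
  simp [glue, h]

omit [Fintype S] in
theorem glue_outer (z : InnerIndex K N w × OuterIndex K N w) {j : Fin k} {s : S}
    (h : s ∉ K (w j)) : glue z j s = z.2 s ⟨j, h⟩ := by
  simp [glue, h]

/-- The unnormalized trace along the cycles of `σ` of matrices on the active legs only. -/
def innerTrace (σ : wordStabilizer w)
    (B : ∀ j, Matrix (K (w j) → Fin N) (K (w j) → Fin N) ℂ) : ℂ :=
  ∑ x : InnerIndex K N w,
    ∏ j, B j (fun s => x s ⟨j, s.2⟩) (fun s => x s (stringPerm K σ s ⟨j, s.2⟩))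

/-- The number of index assignments on the inactive legs that are constant along the cycles
of `σ`. -/
def outerCount (K : I → Finset S) (N : ℕ) (σ : wordStabilizer w) : ℂ :=
  ∑ y : OuterIndex K N w, ∏ j : Fin k,
    if ∀ (s : S) (h : s ∉ K (w j)), y s ⟨j, h⟩ = y s ⟨(σ : Perm (Fin k)) j, by rwa [σ.2 j]⟩
    then 1 else 0

omit [Fintype S] [DecidableEq S] in
theorem mem_apply_iff (σ : wordStabilizer w) {j : Fin k} {s : S} :
    s ∈ K (w ((σ : Perm (Fin k)) j)) ↔ s ∈ K (w j) := by rw [σ.2 j]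

/-- In a trace over all legs, the inactive legs contribute only a count. -/
theorem sum_amplify_eq (σ : wordStabilizer w)
    (B : ∀ j, Matrix (K (w j) → Fin N) (K (w j) → Fin N) ℂ) :
    ∑ c : Fin k → S → Fin N, ∏ j, amplify (K (w j)) N (B j) (c j) (c ((σ : Perm (Fin k)) j)) =
      innerTrace σ B * outerCount K N σ := by
  rw [innerTrace, outerCount, Finset.sum_mul_sum, ← Equiv.sum_comp (glue (K := K) (w := w)),
    Fintype.sum_prod_type]
  refine Finset.sum_congr rfl fun x _ => Finset.sum_congr rfl fun y _ => ?_
  rw [← Finset.prod_mul_distrib]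
  refine Finset.prod_congr rfl fun j _ => ?_
  rw [amplify, Matrix.of_apply, mul_ite, mul_one, mul_zero]
  have h1 : (∀ s, s ∉ K (w j) → glue (x, y) j s = glue (x, y) ((σ : Perm (Fin k)) j) s) ↔
      ∀ (s : S) (h : s ∉ K (w j)), y s ⟨j, h⟩ = y s ⟨(σ : Perm (Fin k)) j, by rwa [σ.2 j]⟩ := by
    refine forall₂_congr fun s h => ?_
    rw [glue_outer _ h, glue_outer _ (by rwa [mem_apply_iff])]
  simp only [h1]
  congr 2
  · funext s
    exact glue_inner _ s.2
  · funext s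
    exact glue_inner _ ((mem_apply_iff σ).2 s.2)

theorem innerTrace_one (σ : wordStabilizer w) :
    innerTrace (K := K) (N := N) σ (fun _ => 1) =
      ∏ s, (N : ℂ) ^ numCycles (stringPerm K σ s) := by
  have h : ∀ s, (N : ℂ) ^ numCycles (stringPerm K σ s) =
      ∑ c : {j // s ∈ K (w j)} → Fin N, if c ∘ stringPerm K σ s = c then 1 else 0 := by
    intro s
    rw [sum_comp_perm_eq, Fintype.card_fin]
  simp_rw [h]
  rw [Fintype.prod_sum, innerTrace]
  refine Finset.sum_congr rfl fun x _ => ?_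
  simp only [Matrix.one_apply, Finset.prod_ite_zero, Finset.prod_const_one, Finset.mem_univ,
    true_implies]
  congr 1
  rw [eq_iff_iff]
  constructor
  · intro h s
    funext j
    exact (congrFun (h j.1) ⟨s, j.2⟩).symm
  · intro h j
    funext s
    exact (congrFun (h s) ⟨j, s.2⟩).symm

/-- The traces over the active legs in terms of the normalized traces over all legs. The
contribution of the inactive legs is the same for the given matrices and for identity matrices,
and it cancels. -/
theorem innerTrace_eq (hN : 0 < N) (σ : wordStabilizer w)
    (B : ∀ j, Matrix (K (w j) → Fin N) (K (w j) → Fin N) ℂ) :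
    innerTrace σ B = trPerm (σ : Perm (Fin k)) (fun j => amplify (K (w j)) N (B j)) *
      ∏ s, (N : ℂ) ^ numCycles (stringPerm K σ s) := by
  have : NeZero N := ⟨hN.ne'⟩
  set d : ℂ := (Fintype.card (S → Fin N) : ℂ) ^ numCycles (σ : Perm (Fin k))
  have hd : d ≠ 0 := pow_ne_zero _ (Nat.cast_ne_zero.2 Fintype.card_ne_zero)
  have h1 : innerTrace σ B * outerCount K N σ = d * trPerm (σ : Perm (Fin k)) _ :=
    (sum_amplify_eq σ B).symm.trans (sum_prod_perm_eq_trPerm _ _)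
  have h2 : (∏ s, (N : ℂ) ^ numCycles (stringPerm K σ s)) * outerCount K N σ = d := by
    rw [← innerTrace_one, ← sum_amplify_eq]
    refine Eq.trans ?_ (sum_comp_perm_eq (β := S → Fin N) (σ : Perm (Fin k)))
    refine Finset.sum_congr rfl fun c _ => ?_
    simp only [amplify_one, Matrix.one_apply, Finset.prod_ite_zero, Finset.prod_const_one,
      Finset.mem_univ, true_implies]
    congr 1
    rw [eq_iff_iff, funext_iff]
    exact forall_congr' fun j => eq_comm
  have h3 : outerCount K N σ ≠ 0 := fun h => hd (by rw [← h2, h, mul_zero])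
  refine mul_right_cancel₀ h3 ?_
  rw [h1, ← h2]
  ring

omit [Fintype S] in
theorem stringPermExt_inner (τ : wordStabilizer w) {j : Fin k} {s : S} (h : s ∈ K (w j)) :
    stringPermExt K τ s j = (τ : Perm (Fin k)) j := by
  exact Perm.ofSubtype_apply_of_mem (p := fun j => s ∈ K (w j)) _ h

omit [Fintype S] in
theorem stringPermExt_outer (τ : wordStabilizer w) {j : Fin k} {s : S} (h : s ∉ K (w j)) :
    stringPermExt K τ s j = j :=
  Perm.ofSubtype_apply_of_not_mem _ h

/-- The number of index assignments `p` with `p ∘ τ_s = p ∘ Z` on every leg `s`; replacing `p` by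
`p ∘ Z⁻¹` turns the condition into constancy along the cycles of `Z⁻¹ τ_s`. -/
theorem sum_string_eq (Z : Perm (Fin k)) (τ : wordStabilizer w) :
    ∑ p : Fin k → S → Fin N,
      (if ∀ j s, p (stringPermExt K τ s j) s = p (Z j) s then (1 : ℂ) else 0) =
      ∏ s, (N : ℂ) ^ numCycles (Z⁻¹ * stringPermExt K τ s) := by
  have h : ∀ s, (N : ℂ) ^ numCycles (Z⁻¹ * stringPermExt K τ s) =
      ∑ c : Fin k → Fin N,
        if ∀ j, c (stringPermExt K τ s j) = c (Z j) then 1 else 0 := by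
    intro s
    rw [← Fintype.card_fin N, ← sum_comp_perm_eq, Fintype.card_fin,
      ← Equiv.sum_comp (Z.arrowCongr (Equiv.refl (Fin N))).symm]
    refine Finset.sum_congr rfl fun c _ => ?_
    congr 1
    rw [eq_iff_iff, funext_iff]
    refine forall_congr' fun j => ?_
    simp [Equiv.arrowCongr]
  simp_rw [h]
  rw [Fintype.prod_sum, ← Equiv.sum_comp (Equiv.piComm fun _ _ => Fin N)]
  refine Finset.sum_congr rfl fun p _ => ?_
  simp only [Finset.prod_ite_zero, Finset.prod_const_one, Finset.mem_univ, true_implies]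
  congr 1
  rw [eq_iff_iff, forall_comm]
  rfl

/-- The sum over all indices for fixed `σ` and `τ`; `Z` is the order of multiplication. The constraints determine `c` and the outer
part of `b`; what remains is the count for `τ` and the trace for `σ`. -/
theorem sum_constrained_eq (Z : Perm (Fin k)) (σ τ : wordStabilizer w)
    (B : ∀ j, Matrix (K (w j) → Fin N) (K (w j) → Fin N) ℂ) :
    ∑ p : Fin k → S → Fin N, ∑ b : Fin k → S → Fin N, ∑ c : Fin k → S → Fin N,
      (∏ j, amplify (K (w j)) N (B j) (b j) (c j)) *
        ((if ∀ j, (∀ s ∉ K (w j), p j s = b j s) ∧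
            (∀ s ∉ K (w j), p (Z j) s = c j s) then 1 else 0) *
          ((if ∀ j, ∀ s ∈ K (w j), b ((σ : Perm (Fin k)) j) s = c j s then 1 else 0) *
            (if ∀ j, ∀ s ∈ K (w j), p ((τ : Perm (Fin k)) j) s = p (Z j) s
              then 1 else 0))) =
      (∏ s, (N : ℂ) ^ numCycles (Z⁻¹ * stringPermExt K τ s)) * innerTrace σ B := by
  rw [← sum_string_eq, Finset.sum_mul]
  refine Finset.sum_congr rfl fun p _ => ?_
  rw [← Equiv.sum_comp (glue (K := K) (w := w)), Fintype.sum_prod_type, innerTrace,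
    Finset.mul_sum]
  refine Finset.sum_congr rfl fun x _ => ?_
  -- The only outer part of `b` and the only `c` that satisfy the constraints.
  let y₀ : OuterIndex K N w := fun s j => p j s
  let c₀ : Fin k → S → Fin N := fun j s =>
    if s ∈ K (w j) then glue (x, y₀) ((σ : Perm (Fin k)) j) s else p (Z j) s
  rw [Finset.sum_eq_single y₀]
  · rw [Finset.sum_eq_single c₀]
    · have e1 : (∀ j, (∀ s ∉ K (w j), p j s = glue (x, y₀) j s) ∧
          (∀ s ∉ K (w j), p (Z j) s = c₀ j s)) := by
        refine fun j => ⟨fun s hs => ?_, fun s hs => ?_⟩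
        · rw [glue_outer _ hs]
        · simp [c₀, hs]
      have e2 : ∀ j, ∀ s ∈ K (w j), glue (x, y₀) ((σ : Perm (Fin k)) j) s = c₀ j s := by
        intro j s hs; simp [c₀, hs]
      rw [if_pos e1, if_pos e2, one_mul, one_mul]
      have e3 : ∀ j, amplify (K (w j)) N (B j) (glue (x, y₀) j) (c₀ j) =
          (if ∀ s ∉ K (w j), p j s = p (Z j) s then 1 else 0) *
          B j (fun s => x s ⟨j, s.2⟩) (fun s => x s (stringPerm K σ s ⟨j, s.2⟩)) := by
        intro j
        rw [amplify, Matrix.of_apply, ite_mul, one_mul, zero_mul]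
        have h1 : (∀ s, s ∉ K (w j) → glue (x, y₀) j s = c₀ j s) ↔
            ∀ s ∉ K (w j), p j s = p (Z j) s := by
          refine forall₂_congr fun s hs => ?_
          rw [glue_outer _ hs]
          simp [c₀, hs, y₀]
        simp only [h1]
        congr 2
        · funext s
          exact glue_inner _ s.2
        · funext s
          simp only [c₀, s.2, if_true]
          exact glue_inner _ ((mem_apply_iff σ).2 s.2)
      simp_rw [e3]
      rw [Finset.prod_mul_distrib, mul_right_comm]
      congr 1
      simp only [Finset.prod_ite_zero, Finset.prod_const_one, Finset.mem_univ, true_implies]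
      rw [boole_mul, ← ite_and]
      congr 1
      rw [eq_iff_iff, ← forall_and]
      refine forall_congr' fun j => ?_
      constructor
      · rintro ⟨h1, h2⟩ s
        by_cases hs : s ∈ K (w j)
        · rw [stringPermExt_inner τ hs, h2 s hs]
        · rw [stringPermExt_outer τ hs, h1 s hs]
      · refine fun h => ⟨fun s hs => ?_, fun s hs => ?_⟩
        · rw [← h s, stringPermExt_outer τ hs]
        · rw [← h s, stringPermExt_inner τ hs]
    · intro c _ hc
      by_cases h1 : ∀ j, (∀ s ∉ K (w j), p j s = glue (x, y₀) j s) ∧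
          (∀ s ∉ K (w j), p (Z j) s = c j s)
      · rw [if_neg (c := ∀ j, ∀ s ∈ K (w j), glue (x, y₀) ((σ : Perm (Fin k)) j) s = c j s)]
        · simp
        · intro h2
          refine hc ?_
          funext j s
          by_cases hs : s ∈ K (w j)
          · simp [c₀, hs, h2 j s hs]
          · simp [c₀, hs, (h1 j).2 s hs]
      · rw [if_neg h1]
        simp
    · simp
  · intro y _ hy
    refine Finset.sum_eq_zero fun c _ => ?_
    rw [if_neg]
    · simp
    · intro h
      refine hy ?_
      funext s j
      have := (h j).1 s j.2
      rw [glue_outer _ j.2] at this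
      exact this.symm
  · simp

end IndexSums

/-! ### Haar unitaries of the leg algebras -/

section LegUnitary

variable {S : Type*} [Fintype S] [DecidableEq S] (K : Finset S) (N : ℕ) [NeZero N]

/-- The compression of a matrix on all legs to the legs in `K`, with the indices of the other legs
set to `0`. On the leg algebra it inverts `amplify`. -/
def compress (X : TensorMatrix S N) : Matrix (K → Fin N) (K → Fin N) ℂ :=
  Matrix.of fun x y => X (fun s => if h : s ∈ K then x ⟨s, h⟩ else 0)
    (fun s => if h : s ∈ K then y ⟨s, h⟩ else 0)

theorem compress_amplify (B : Matrix (K → Fin N) (K → Fin N) ℂ) :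
    compress K N (amplify K N B) = B := by
  ext x y
  simp only [compress, amplify, Matrix.of_apply]
  rw [if_pos (fun s hs => by simp [hs])]
  simp

variable {K N}

theorem amplify_compress {X : TensorMatrix S N} (hX : X ∈ legAlgebra K N) :
    amplify K N (compress K N X) = X := by
  obtain ⟨B, rfl⟩ := hX
  rw [compress_amplify]

variable (K N)

/-- A unitary of the leg algebra as a matrix on the legs in `K`. Its image is the full unitary group
there, see `legHom_mem_unitaryGroup` and `exists_legHom_eq`. -/
def legHom : LegUnitary K N →* Matrix (K → Fin N) (K → Fin N) ℂ where
  toFun u := compress K N u.toMatrix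
  map_one' := by
    change compress K N 1 = 1
    rw [← amplify_one, compress_amplify]
  map_mul' u v := by
    change compress K N (u.toMatrix * v.toMatrix) = _
    have hu : amplify K N (compress K N u.toMatrix) = u.toMatrix := amplify_compress u.1.2
    have hv : amplify K N (compress K N v.toMatrix) = v.toMatrix := amplify_compress v.1.2
    conv_lhs => rw [← hu, ← hv]
    rw [← amplify_mul, compress_amplify]

variable {K N}

theorem amplify_legHom (u : LegUnitary K N) : amplify K N (legHom K N u) = u.toMatrix :=
  amplify_compress u.1.2

theorem legHom_mem_unitaryGroup (u : LegUnitary K N) :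
    legHom K N u ∈ Matrix.unitaryGroup (K → Fin N) ℂ := by
  rw [Matrix.mem_unitaryGroup_iff, ← compress_amplify K N (legHom K N u * _), amplify_mul,
    amplify_star, amplify_legHom]
  have : u.toMatrix * star u.toMatrix = 1 := congrArg Subtype.val (Unitary.mul_star_self_of_mem u.2)
  rw [this, ← amplify_one, compress_amplify]

theorem exists_legHom_eq {V : Matrix (K → Fin N) (K → Fin N) ℂ}
    (hV : V ∈ Matrix.unitaryGroup (K → Fin N) ℂ) : ∃ u, legHom K N u = V := by
  let v : legAlgebra K N := ⟨amplify K N V, V, rfl⟩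
  have hv : v ∈ unitary (legAlgebra K N) := by
    rw [Unitary.mem_iff]
    constructor
    · refine Subtype.ext ?_
      change star (amplify K N V) * amplify K N V = 1
      rw [← amplify_star, ← amplify_mul, Matrix.mem_unitaryGroup_iff'.1 hV, amplify_one]
    · refine Subtype.ext ?_
      change amplify K N V * star (amplify K N V) = 1
      rw [← amplify_star, ← amplify_mul, Matrix.mem_unitaryGroup_iff.1 hV, amplify_one]
  exact ⟨⟨v, hv⟩, compress_amplify K N V⟩

theorem measurable_legHom_apply (x y : K → Fin N) :
    Measurable fun u : LegUnitary K N => legHom K N u x y := by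
  refine Continuous.measurable ?_
  have h : Continuous fun u : LegUnitary K N => u.toMatrix :=
    continuous_subtype_val.comp continuous_subtype_val
  exact h.matrix_elem _ _

end LegUnitary

/-! ### Joint moments of independent Haar unitaries -/

section JointMoments

variable {I : Type*} [DecidableEq I] {k : ℕ} {w : Fin k → I}

/-- A permutation in the stabilizer of a word amounts to a permutation of each block. -/
def blockEquiv (w : Fin k → I) :
    wordStabilizer w ≃ ∀ i : Finset.univ.image w, Perm {j // w j = (i : I)} :=
  Equiv.ofBijective (fun σ i => blockPerm σ (i : I)) (by
    constructor
    · intro σ τ h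
      refine Subtype.ext (Equiv.ext fun j => ?_)
      have := congrFun h ⟨w j, Finset.mem_image_of_mem _ (Finset.mem_univ j)⟩
      exact congrArg Subtype.val (congrArg (fun e : Perm {l // w l = w j} => e ⟨j, rfl⟩) this)
    · intro f
      let im : ∀ j, Finset.univ.image w := fun j =>
        ⟨w j, Finset.mem_image_of_mem _ (Finset.mem_univ j)⟩
      have key : ∀ (g : ∀ i : Finset.univ.image w, Perm {j // w j = (i : I)})
          (i : Finset.univ.image w) (j : {j // w j = (i : I)}),
          g (im j) ⟨j, rfl⟩ = (g i j : Fin k) := by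
        rintro g ⟨i, hi⟩ ⟨j, hj⟩
        dsimp only at hj
        subst hj
        rfl
      let σ : Perm (Fin k) :=
        { toFun := fun j => f (im j) ⟨j, rfl⟩
          invFun := fun j => (f (im j)).symm ⟨j, rfl⟩
          left_inv := fun j => by
            have := key (fun i => (f i).symm) (im j) (f (im j) ⟨j, rfl⟩)
            simpa using this
          right_inv := fun j => by
            have := key f (im j) ((f (im j)).symm ⟨j, rfl⟩)
            simpa using this }
      refine ⟨⟨σ, fun j => (f (im j) ⟨j, rfl⟩).2⟩, ?_⟩
      funext i
      ext j
      exact congrArg Fin.val (key f i j))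

omit [DecidableEq I] in
theorem blockPerm_inv_mul (σ τ : wordStabilizer w) (i : I) :
    blockPerm (σ⁻¹ * τ) i = (blockPerm σ i)⁻¹ * blockPerm τ i := by
  rw [eq_inv_mul_iff_mul_eq]
  ext j
  simp [blockPerm]

variable {S Ω : Type*} [Fintype S] [DecidableEq S] {K : I → Finset S} {N : ℕ} [NeZero N]
  [MeasurableSpace Ω] {P : Measure Ω} [IsProbabilityMeasure P]
  {U : ∀ i, Ω → LegUnitary (K i) N}

/-- The contribution of the position `j` to a joint moment, if the letter there is `i`. -/
def legFactor (i : I) (u : LegUnitary (K i) N) (a b a' c : S → Fin N) : ℂ :=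
  legHom (K i) N u (fun s => a s) (fun s => b s) *
    star (legHom (K i) N u (fun s => a' s) (fun s => c s))

/-- The indices of the letters `i` of the word, on the legs where `i` acts. -/
def blockIndex (K : I → Finset S) (p : Fin k → S → Fin N) (i : I) :
    {j // w j = i} → K i → Fin N :=
  fun j s => p j s

/-- The Weingarten formula for the joint moments: by independence, the moment is the product over
the blocks of the word of moments of a single Haar unitary. -/
theorem integral_prod_legFactor (hUmeas : ∀ i, Measurable (U i)) (hUindep : iIndepFun U P)
    (hUhaar : ∀ i, (P.map (U i)).IsHaarMeasure) (a b a' c : Fin k → S → Fin N) :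
    ∫ ω, ∏ j, legFactor (w j) (U (w j) ω) (a j) (b j) (a' j) (c j) ∂P =
      ∑ σ : wordStabilizer w, ∑ τ : wordStabilizer w, wgTilde K (σ⁻¹ * τ) N *
        (if ∀ j, ∀ s ∈ K (w j), b ((σ : Perm (Fin k)) j) s = c j s then 1 else 0) *
        (if ∀ j, ∀ s ∈ K (w j), a ((τ : Perm (Fin k)) j) s = a' j s then 1 else 0) := by
  let f : ∀ i : Finset.univ.image w, LegUnitary (K i) N → ℂ := fun i u =>
    entryProd (B := {j // w j = (i : I)}) (legHom (K i) N u)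
      (blockIndex K a i) (blockIndex K b i) (blockIndex K a' i) (blockIndex K c i)
  have h1 : ∀ ω, ∏ j, legFactor (w j) (U (w j) ω) (a j) (b j) (a' j) (c j) =
      ∏ i, f i (U i ω) := by
    intro ω
    rw [← Finset.prod_fiberwise_of_maps_to (g := w) (t := Finset.univ.image w)
      (fun j hj => Finset.mem_image_of_mem _ hj), ← Finset.prod_coe_sort]
    refine Finset.prod_congr rfl fun i _ => ?_
    rw [Finset.prod_subtype (p := fun j => w j = (i : I)) _ (by simp)]
    refine Finset.prod_congr rfl ?_
    obtain ⟨i, hi⟩ := i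
    rintro ⟨j, hj⟩ _
    dsimp only at hj
    subst hj
    rfl
  have hmeas : ∀ i : Finset.univ.image w, Measurable (f i) := fun i =>
    measurable_entryProd measurable_legHom_apply _ _ _ _
  have h2 : ∀ i : Finset.univ.image w, ∫ ω, f i (U i ω) ∂P =
      ∑ σ : Perm {j // w j = (i : I)}, ∑ τ : Perm {j // w j = (i : I)},
        Wg (σ⁻¹ * τ) (N ^ (K i).card) *
        (if blockIndex K b (i : I) ∘ σ = blockIndex K c i then 1 else 0) *
        (if blockIndex K a (i : I) ∘ τ = blockIndex K a' i then 1 else 0) := by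
    intro i
    have := hUhaar i
    have := Measure.isProbabilityMeasure_map (μ := P) (hUmeas i).aemeasurable
    rw [← integral_map (hUmeas i).aemeasurable (hmeas i).aestronglyMeasurable]
    rw [integral_entryProd (P.map (U i)) (legHom (K i) N) measurable_legHom_apply
      legHom_mem_unitaryGroup (fun V hV => exists_legHom_eq hV)]
    simp only [Fintype.card_fun, Fintype.card_fin, Fintype.card_coe]
  simp_rw [h1]
  rw [(hUindep.precomp (g := fun i : Finset.univ.image w => (i : I))
    Subtype.val_injective).integral_fun_prod_comp (fun i => (hUmeas i).aemeasurable)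
    (fun i => (hmeas i).aestronglyMeasurable)]
  simp_rw [h2]
  rw [Fintype.prod_sum, ← Equiv.sum_comp (blockEquiv w)]
  refine Finset.sum_congr rfl fun σ _ => ?_
  rw [Fintype.prod_sum, ← Equiv.sum_comp (blockEquiv w)]
  refine Finset.sum_congr rfl fun τ _ => ?_
  rw [Finset.prod_mul_distrib, Finset.prod_mul_distrib]
  have h3 : ∀ (ρ : wordStabilizer w) (p q : Fin k → S → Fin N),
      (∏ i : Finset.univ.image w,
        if blockIndex K p (i : I) ∘ (blockEquiv w ρ i) = blockIndex K q i then (1 : ℂ) else 0) =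
      if ∀ j, ∀ s ∈ K (w j), p ((ρ : Perm (Fin k)) j) s = q j s then 1 else 0 := by
    intro ρ p q
    simp only [Finset.prod_ite_zero, Finset.prod_const_one, Finset.mem_univ, true_implies]
    congr 1
    rw [eq_iff_iff]
    constructor
    · intro h j s hs
      exact congrFun (congrFun (h ⟨w j, Finset.mem_image_of_mem _ (Finset.mem_univ j)⟩)
        ⟨j, rfl⟩) ⟨s, hs⟩
    · intro h i
      funext ⟨j, hj⟩ s
      exact h j s (by rw [hj]; exact s.2)
  rw [h3, h3]
  congr 2
  rw [wgTilde, ← Finset.prod_coe_sort (Finset.univ.image w)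
    fun i => Wg (blockPerm (σ⁻¹ * τ) i) (N ^ (K i).card)]
  refine Finset.prod_congr rfl fun i _ => ?_
  rw [blockPerm_inv_mul]
  rfl

omit [DecidableEq I] in
theorem integrable_prod_legFactor (hUmeas : ∀ i, Measurable (U i)) (a b a' c : Fin k → S → Fin N) :
    Integrable (fun ω => ∏ j, legFactor (w j) (U (w j) ω) (a j) (b j) (a' j) (c j)) P := by
  refine Integrable.of_bound (Measurable.aestronglyMeasurable ?_) 1
    (Filter.Eventually.of_forall fun ω => ?_)
  · refine Finset.measurable_prod _ fun j _ => ?_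
    exact ((measurable_legHom_apply _ _).comp (hUmeas _)).mul
      (continuous_star.measurable.comp ((measurable_legHom_apply _ _).comp (hUmeas _)))
  · rw [norm_prod]
    refine Finset.prod_le_one (fun _ _ => norm_nonneg _) fun j _ => ?_
    rw [legFactor, norm_mul, norm_star]
    exact mul_le_one₀ (entry_norm_bound_of_unitary (legHom_mem_unitaryGroup _) _ _)
      (norm_nonneg _) (entry_norm_bound_of_unitary (legHom_mem_unitaryGroup _) _ _)

/-! ### Expansion of the trace of the word -/

theorem toMatrix_apply {K : Finset S} (u : LegUnitary K N) (a b : S → Fin N) :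
    u.toMatrix a b = if ∀ s ∉ K, a s = b s then
      legHom K N u (fun s => a s) (fun s => b s) else 0 := by
  rw [← amplify_legHom]
  rfl

omit [DecidableEq I] in
theorem prod_toMatrix_mul_star (u : ∀ i, LegUnitary (K i) N) (a b a' c : Fin k → S → Fin N) :
    ∏ j, (u (w j)).toMatrix (a j) (b j) * star ((u (w j)).toMatrix (a' j) (c j)) =
      (if ∀ j, (∀ s ∉ K (w j), a j s = b j s) ∧ (∀ s ∉ K (w j), a' j s = c j s)
        then 1 else 0) * ∏ j, legFactor (w j) (u (w j)) (a j) (b j) (a' j) (c j) := by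
  have h : ∀ j, (u (w j)).toMatrix (a j) (b j) * star ((u (w j)).toMatrix (a' j) (c j)) =
      (if (∀ s ∉ K (w j), a j s = b j s) ∧ (∀ s ∉ K (w j), a' j s = c j s) then 1 else 0) *
        legFactor (w j) (u (w j)) (a j) (b j) (a' j) (c j) := by
    intro j
    rw [toMatrix_apply, toMatrix_apply, legFactor, ite_and]
    split_ifs <;> simp
  simp_rw [h, Finset.prod_mul_distrib, Finset.prod_ite_zero]
  simp

omit [DecidableEq I] in
theorem ntr_wordProd (hk : 0 < k) (A : Fin k → TensorMatrix S N) (u : ∀ i, LegUnitary (K i) N) :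
    ntr (wordProd w A u) = ((N : ℂ) ^ Fintype.card S)⁻¹ *
      ∑ p : Fin k → S → Fin N, ∑ b : Fin k → S → Fin N, ∑ c : Fin k → S → Fin N,
        (∏ j, A j (b j) (c j)) *
        ((if ∀ j, (∀ s ∉ K (w j), p j s = b j s) ∧
            (∀ s ∉ K (w j), p (finRotate k j) s = c j s) then 1 else 0) *
          ∏ j, legFactor (w j) (u (w j)) (p j) (b j) (p (finRotate k j)) (c j)) := by
  rw [ntr, wordProd, trace_ofFn_prod hk]
  congr 1
  · simp
  refine Finset.sum_congr rfl fun p _ => ?_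
  have h : ∀ j, ((u (w j)).toMatrix * A j * star (u (w j)).toMatrix) (p j) (p (finRotate k j)) =
      ∑ b, ∑ c, A j b c * ((u (w j)).toMatrix (p j) b *
        star ((u (w j)).toMatrix (p (finRotate k j)) c)) := by
    intro j
    simp only [Matrix.mul_apply, Finset.sum_mul, Matrix.star_apply]
    rw [Finset.sum_comm]
    refine Finset.sum_congr rfl fun b _ => Finset.sum_congr rfl fun c _ => ?_
    ring
  simp_rw [h, Fintype.prod_sum, ← prod_toMatrix_mul_star, Finset.prod_mul_distrib]

theorem sum_sum_sum_comm {α β γ δ : Type*} [Fintype α] [Fintype β] [Fintype γ] [Fintype δ]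
    (f : α → β → γ → δ → ℂ) :
    ∑ a, ∑ b, ∑ c, ∑ d, f a b c d = ∑ d, ∑ a, ∑ b, ∑ c, f a b c d := by
  symm
  rw [Finset.sum_comm]
  refine Finset.sum_congr rfl fun a _ => ?_
  rw [Finset.sum_comm]
  refine Finset.sum_congr rfl fun b _ => ?_
  rw [Finset.sum_comm]

omit [DecidableEq S] [NeZero N] in
theorem prod_zpow_string_eq (hN : (N : ℂ) ≠ 0) (x y : S → ℕ) :
    ∏ s : S, (N : ℂ) ^ ((x s : ℤ) + (y s : ℤ) - 1) =
      ((N : ℂ) ^ Fintype.card S)⁻¹ * ((∏ s, (N : ℂ) ^ x s) * ∏ s, (N : ℂ) ^ y s) := by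
  simp_rw [zpow_sub₀ hN, zpow_add₀ hN, zpow_natCast, zpow_one, div_eq_mul_inv,
    Finset.prod_mul_distrib]
  rw [Finset.prod_const, Finset.card_univ, inv_pow]
  ring

end JointMoments

end EpsWeingarten

end

theorem mainTheorem3 {S I Ω : Type*} [Fintype S] [DecidableEq S] [DecidableEq I]
    [MeasurableSpace Ω] (P : MeasureTheory.Measure Ω) [MeasureTheory.IsProbabilityMeasure P]
    (K : I → Finset S) (hK : ∀ i, (K i).Nonempty)
    (N : ℕ) (hN : 0 < N) (k : ℕ) (hk : 0 < k) (w : Fin k → I)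
    (U : ∀ i, Ω → EpsWeingarten.LegUnitary (K i) N)
    (hUmeas : ∀ i, Measurable (U i))
    (hUindep : ProbabilityTheory.iIndepFun U P)
    (hUhaar : ∀ i, (P.map (U i)).IsHaarMeasure)
    (A : Fin k → EpsWeingarten.TensorMatrix S N)
    (hA : ∀ j, A j ∈ EpsWeingarten.legAlgebra (K (w j)) N) :
    MeasureTheory.Integrable
      (fun ω => EpsWeingarten.ntr (EpsWeingarten.wordProd w A fun i => U i ω)) P ∧
    ∫ ω, EpsWeingarten.ntr (EpsWeingarten.wordProd w A fun i => U i ω) ∂P =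
      ∑ σ : EpsWeingarten.wordStabilizer w, ∑ τ : EpsWeingarten.wordStabilizer w,
        EpsWeingarten.wgTilde K (σ⁻¹ * τ) N *
          EpsWeingarten.trPerm (σ : Equiv.Perm (Fin k)) A *
          ∏ s : S, (N : ℂ) ^
            ((EpsWeingarten.numCycles ((finRotate k)⁻¹ * EpsWeingarten.stringPermExt K τ s) : ℤ) +
              (EpsWeingarten.numCycles (EpsWeingarten.stringPerm K σ s) : ℤ) - 1) := by
  open EpsWeingarten in
  have : NeZero N := ⟨hN.ne'⟩
  have hN' : (N : ℂ) ≠ 0 := Nat.cast_ne_zero.2 hN.ne'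
  choose B hB using hA
  obtain rfl : (fun j => amplify (K (w j)) N (B j)) = A := funext hB
  have hint : ∀ p b c : Fin k → S → Fin N, Integrable (fun ω =>
      (∏ j, amplify (K (w j)) N (B j) (b j) (c j)) *
        ((if ∀ j, (∀ s ∉ K (w j), p j s = b j s) ∧
            (∀ s ∉ K (w j), p (finRotate k j) s = c j s) then 1 else 0) *
          ∏ j, legFactor (w j) (U (w j) ω) (p j) (b j) (p (finRotate k j)) (c j))) P :=
    fun p b c => ((integrable_prod_legFactor hUmeas _ _ _ _).const_mul _).const_mul _
  simp_rw [ntr_wordProd hk]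
  refine ⟨(integrable_finsetSum _ fun p _ => integrable_finsetSum _ fun b _ =>
    integrable_finsetSum _ fun c _ => hint p b c).const_mul _, ?_⟩
  rw [integral_const_mul, integral_finsetSum _ fun p _ => integrable_finsetSum _ fun b _ =>
    integrable_finsetSum _ fun c _ => hint p b c]
  simp_rw [fun p => integral_finsetSum (μ := P) Finset.univ fun b _ =>
    integrable_finsetSum Finset.univ fun c _ => hint p b c,
    fun p b => integral_finsetSum (μ := P) Finset.univ fun c _ => hint p b c,
    integral_const_mul, integral_prod_legFactor hUmeas hUindep hUhaar,
    prod_zpow_string_eq hN']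
  have hστ : ∀ σ τ : wordStabilizer w, wgTilde K (σ⁻¹ * τ) N *
      trPerm (σ : Perm (Fin k)) (fun j => amplify (K (w j)) N (B j)) *
      (((N : ℂ) ^ Fintype.card S)⁻¹ *
        ((∏ s, (N : ℂ) ^ numCycles ((finRotate k)⁻¹ * stringPermExt K τ s)) *
          ∏ s, (N : ℂ) ^ numCycles (stringPerm K σ s))) =
      ((N : ℂ) ^ Fintype.card S)⁻¹ * (wgTilde K (σ⁻¹ * τ) N *
        ((∏ s, (N : ℂ) ^ numCycles ((finRotate k)⁻¹ * stringPermExt K τ s)) *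
          innerTrace σ B)) := by
    intro σ τ
    rw [innerTrace_eq hN]
    ring
  simp_rw [hστ, ← Finset.mul_sum]
  congr 1
  simp_rw [← sum_constrained_eq, Finset.mul_sum]
  rw [sum_sum_sum_comm]
  refine Finset.sum_congr rfl fun σ _ => ?_
  rw [sum_sum_sum_comm]
  refine Finset.sum_congr rfl fun τ _ => Finset.sum_congr rfl fun p _ =>
    Finset.sum_congr rfl fun b _ => Finset.sum_congr rfl fun c _ => ?_
  ring
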